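/- **Definitions.** Let $F$ be a field. A depth-3 circuit in $n$ variables with top fan-in $k$ is $C=\sum_{i=1}^{k}a_i\prod_{j=1}^{n_i}\ell_{ij}$ with $a_i\in F$ and linear polynomials $\ell_{ij}=b_0+\sum_r b_rx_r$ over $F$; it is multilinear if the polynomial computed at every gate is multilinear. A partition of the variables is induced by the $i$-th product gate if two variables that occur in the $i$-th product have the same color (lie in the same part) exactly when they occur in the same factor $\ell_{ij}$; a variable that does not occur may have any color. A sequence $P_1,\dots,P_k$ of partitions of the variables has distance at most $\delta$ if for every $i\ge 2$ each color of $P_i$ belongs to a set of at most $\delta$ colors of $P_i$ whose union is, for every $j<i$, a union of colors of $P_j$. A circuit has $\delta$-distance if its product gates can be ordered so that they induce a sequence of partitions of distance at most $\delta$. Given a partition of the variables into $m$ base sets, $C$ has $\delta$-distance on the base sets if for each base set $B$ the circuit obtained from $C$ by substituting $0$ for all variables outside $B$ has $\delta$-distance (the order of the gates may depend on $B$). **Theorem.** Put $\ell_0=\lceil\log_2(k+1)\rceil$ and $\ell=\ell_0+\delta+1$. (1) There are a constant $c$ and a single program for a random access machine over a field (unit-cost addition, truncated subtraction and comparison of natural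 numbers, ring operations on field elements, access to a list of field elements) with the following property. Let $n,\delta,k\ge 1$, let a partition of the $n$ variables into $m$ base sets be given, and let $K$ be a field with a list of elements whose first $(n+1)^{c\,\delta\,\ell_0}$ entries are distinct. On the input $n,m,\delta,k$ and the base sets, the program halts within $(n+1)^{c\,m\,\delta\,\ell_0}=n^{O(m\delta\log k)}$ steps (the equality for $n,k\ge 2$) and prints a list $H$ of points of $K^n$ such that, for every subfield $F$ of $K$, every multilinear depth-3 circuit $C$ over $F$ with top fan-in $k$ that has $\delta$-distance on the given base sets and computes a nonzero polynomial satisfies $C(x)\ne 0$ for some $x\in H$. (2) Let $C$ be a multilinear depth-3 circuit over a field $F$ with top fan-in $k\ge1$ that has $\delta$-distance, $\delta\ge1$, on $m$ given base sets, and let $D=\bigl(\prod_j\ell_{ij}\bigr)_{i=1}^{k}$. Take a separate shift variable $t_b$ for each base set $b$, and exponents $w_r\ge 0$ such that, within each base set, distinct sets $S$ of at most $\delta\ell_0$ variables have distinct sums $\sum_{r\in S}w_r$. Then the polynomial vector $D'$ obtained from $D$ by replacing every $x_r$ by $x_r+t_b^{w_r}$, where $b$ is the base set of $x_r$, is $(m(\ell-1)+1)$-concentrated: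 over $F(t_1,\dots,t_m)$, the coefficient vectors in $D'$ of the multilinear monomials in fewer than $m(\ell-1)+1$ variables have the same rank as the coefficient vectors of all multilinear monomials. -/

import Mathlib

universe u v

/-! ### Depth-3 circuits -/

/-- A linear polynomial `b₀ + ∑ r, b r * x r` in the variables `x₀, …, xₙ₋₁`. -/
structure LinForm (F : Type*) (n : ℕ) where
  const : F
  coef : Fin n → F

namespace LinForm

variable {F : Type*} [Field F] {n : ℕ}

noncomputable def poly (p : LinForm F n) : MvPolynomial (Fin n) F :=
  MvPolynomial.C p.const + ∑ r, MvPolynomial.C (p.coef r) * MvPolynomial.X r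

/-- The variable `x r` is present in the linear polynomial. -/
def Present (p : LinForm F n) (r : Fin n) : Prop := p.coef r ≠ 0

open Classical in
/-- Substitute `0` for all variables outside `B`. -/
noncomputable def restrict (p : LinForm F n) (B : Set (Fin n)) : LinForm F n where
  const := p.const
  coef r := if r ∈ B then p.coef r else 0

end LinForm

/-- A depth-3 circuit `∑ i, a i * ∏ j, ℓ i j` in `n` variables with top fan-in `k`; the `i`-th
product gate has fan-in `fanin i`. -/
structure Depth3Circuit (F : Type*) (n k : ℕ) where
  weight : Fin k → F
  fanin : Fin k → ℕ
  lin : (i : Fin k) → Fin (fanin i) → LinForm F n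

/-- The distance of the sequence `P 0, …, P (k - 1)` of partitions of the variables is at most
`δ`: every color `Y` of a partition lies in a set `N` of at most `δ` colors of that partition whose
union is, for every earlier partition, a union of colors of that earlier partition. -/
def PartitionDistLE {n k : ℕ} (P : Fin k → Finpartition (Finset.univ : Finset (Fin n)))
    (δ : ℕ) : Prop :=
  ∀ i : Fin k, 0 < (i : ℕ) → ∀ Y ∈ (P i).parts,
    ∃ N ⊆ (P i).parts, Y ∈ N ∧ N.card ≤ δ ∧
      ∀ j < i, ∃ Z ⊆ (P j).parts, Z.sup id = N.sup id

namespace Depth3Circuit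

variable {F : Type*} [Field F] {n k : ℕ}

/-- The polynomial computed at the `i`-th product gate. -/
noncomputable def gate (Q : Depth3Circuit F n k) (i : Fin k) : MvPolynomial (Fin n) F :=
  ∏ j, (Q.lin i j).poly

/-- The polynomial computed by the circuit. -/
noncomputable def poly (Q : Depth3Circuit F n k) : MvPolynomial (Fin n) F :=
  ∑ i, MvPolynomial.C (Q.weight i) * Q.gate i

/-- The polynomial computed at every gate (bottom sums, products, output) is multilinear. -/
def IsMultilinear (Q : Depth3Circuit F n k) : Prop :=
  (∀ i j r, (Q.lin i j).poly.degreeOf r ≤ 1) ∧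
    (∀ i r, (Q.gate i).degreeOf r ≤ 1) ∧ ∀ r, Q.poly.degreeOf r ≤ 1

/-- The partition `P` is induced by the `i`-th product gate: variables that are present at the gate
have the same color exactly when they are present in the same linear factor. A variable that is
absent from the gate may be given any color (it may be added to a factor, or to the
factor `1`, with coefficient `0`). -/
def Induces (Q : Depth3Circuit F n k) (i : Fin k)
    (P : Finpartition (Finset.univ : Finset (Fin n))) : Prop :=
  ∀ j j' r r', (Q.lin i j).Present r → (Q.lin i j').Present r' →
    (P.part r = P.part r' ↔ j = j')

/-- The product gates can be ordered so that they induce a partition sequence of distance at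
most `δ`. -/
def HasDistance (Q : Depth3Circuit F n k) (δ : ℕ) : Prop :=
  ∃ (e : Equiv.Perm (Fin k)) (P : Fin k → Finpartition (Finset.univ : Finset (Fin n))),
    (∀ i, Q.Induces (e i) (P i)) ∧ PartitionDistLE P δ

/-- The circuit with `0` substituted for all variables outside `B`. -/
noncomputable def restrict (Q : Depth3Circuit F n k) (B : Set (Fin n)) :
    Depth3Circuit F n k where
  weight := Q.weight
  fanin := Q.fanin
  lin i j := (Q.lin i j).restrict B

/-- The circuit has `δ`-distance on each of the `m` base sets `{r | base r = b}`, `b < m`. The order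
of the gates may depend on the base set. -/
def HasBaseSetsDistance {m : ℕ} (Q : Depth3Circuit F n k) (base : Fin n → Fin m) (δ : ℕ) : Prop :=
  ∀ b, (Q.restrict {r | base r = b}).HasDistance δ

/-- The field of rational functions in the shift variables `t₀, …, tₘ₋₁`. -/
abbrev ShiftField (F : Type*) [Field F] (m : ℕ) : Type _ :=
  FractionRing (MvPolynomial (Fin m) F)

/-- The `i`-th coordinate of `D(x + φ(t))`, where `D` is the vector of product gates and the shift
of `x r` is the `w r`-th power of the shift variable of the base set of `x r`. -/
noncomputable def shiftedGate {m : ℕ} (Q : Depth3Circuit F n k) (base : Fin n → Fin m)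
    (w : Fin n → ℕ) (i : Fin k) : MvPolynomial (Fin n) (ShiftField F m) :=
  MvPolynomial.aeval
    (fun r => MvPolynomial.X r + MvPolynomial.C
      (algebraMap (MvPolynomial (Fin m) F) (ShiftField F m) (MvPolynomial.X (base r) ^ w r)))
    (Q.gate i)

end Depth3Circuit

/-- The coefficient vector of the monomial `∏ r ∈ S, x r` in a vector of `k` polynomials. -/
noncomputable def coefVec {L : Type*} [Field L] {n k : ℕ} (D : Fin k → MvPolynomial (Fin n) L)
    (S : Finset (Fin n)) : Fin k → L :=
  fun i => (D i).coeff (∑ r ∈ S, Finsupp.single r 1)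

/-- `ℓ`-concentration: the coefficient vectors of the multilinear monomials of support less
than `ℓ` have the same rank as those of all multilinear monomials. -/
def IsConcentrated {L : Type*} [Field L] {n k : ℕ} (D : Fin k → MvPolynomial (Fin n) L)
    (ℓ : ℕ) : Prop :=
  Set.finrank L {u | ∃ S : Finset (Fin n), S.card < ℓ ∧ coefVec D S = u} =
    Set.finrank L {u | ∃ S : Finset (Fin n), coefVec D S = u}

/-- Within each base set, the weights `w` separate the multilinear monomials of support at
most `s`. -/
def SeparatesBaseSets {n m : ℕ} (base : Fin n → Fin m) (w : Fin n → ℕ) (s : ℕ) : Prop :=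
  ∀ b, ∀ S T : Finset (Fin n), (∀ r ∈ S, base r = b) → (∀ r ∈ T, base r = b) →
    S.card ≤ s → T.card ≤ s → ∑ r ∈ S, w r = ∑ r ∈ T, w r → S = T

/-! ### Random access machines over a field

Structured programs for a unit-cost random access machine with one memory for natural numbers and
one memory for field elements. On natural numbers there are only constants, addition, truncated
subtraction, comparison and indirect addressing (no multiplication, so that unit cost is
realistic). On field elements there are `0`, `1`, the ring operations and access to a given list
`elem 0, elem 1, …` of field elements. A program is a finite text that does not mention the
field. -/

namespace FieldRAM

/-- Expressions of natural-number type; `read a` is the content of the cell with address `a`. -/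
inductive NExp where
  | const (c : ℕ)
  | read (a : NExp)
  | add (a b : NExp)
  | sub (a b : NExp)

/-- Expressions of field type; `read a` is the content of the field cell with address `a`. -/
inductive FExp where
  | zero
  | one
  | read (a : NExp)
  | elem (a : NExp)
  | neg (x : FExp)
  | add (x y : FExp)
  | mul (x y : FExp)

/-- Programs. The tests of `ite` and `while` are `a < b`. -/
inductive Prog where
  | skip
  | setN (a e : NExp)
  | setF (a : NExp) (x : FExp)
  | emit (x : FExp)
  | seq (p q : Prog)
  | ite (a b : NExp) (p q : Prog)
  | while (a b : NExp) (p : Prog)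

structure State (K : Type*) where
  mem : ℕ → ℕ
  fmem : ℕ → K
  out : List K

namespace NExp

def eval (mem : ℕ → ℕ) : NExp → ℕ
  | const c => c
  | read a => mem (a.eval mem)
  | add a b => a.eval mem + b.eval mem
  | sub a b => a.eval mem - b.eval mem

/-- One step for every node of the expression. -/
def cost : NExp → ℕ
  | const _ => 1
  | read a => a.cost + 1
  | add a b => a.cost + b.cost + 1
  | sub a b => a.cost + b.cost + 1

end NExp

namespace FExp

def eval {K : Type*} [Field K] (elem : ℕ → K) (s : State K) : FExp → K
  | zero => 0
  | one => 1
  | read a => s.fmem (a.eval s.mem)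
  | .elem a => elem (a.eval s.mem)
  | neg x => - x.eval elem s
  | add x y => x.eval elem s + y.eval elem s
  | mul x y => x.eval elem s * y.eval elem s

/-- One step for every node of the expression. -/
def cost : FExp → ℕ
  | zero => 1
  | one => 1
  | read a => a.cost + 1
  | .elem a => a.cost + 1
  | neg x => x.cost + 1
  | add x y => x.cost + y.cost + 1
  | mul x y => x.cost + y.cost + 1

end FExp

/-- `Exec elem p s t s'`: started in the state `s`, the program `p` halts after exactly `t` steps in
the state `s'`. -/
inductive Exec {K : Type*} [Field K] (elem : ℕ → K) : Prog → State K → ℕ → State K → Prop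
  | skip (s) : Exec elem .skip s 1 s
  | setN (a e s) : Exec elem (.setN a e) s (a.cost + e.cost + 1)
      { s with mem := Function.update s.mem (a.eval s.mem) (e.eval s.mem) }
  | setF (a x s) : Exec elem (.setF a x) s (a.cost + x.cost + 1)
      { s with fmem := Function.update s.fmem (a.eval s.mem) (x.eval elem s) }
  | emit (x s) : Exec elem (.emit x) s (x.cost + 1) { s with out := s.out ++ [x.eval elem s] }
  | seq {p q s t s' t' s''} : Exec elem p s t s' → Exec elem q s' t' s'' →
      Exec elem (.seq p q) s (t + t' + 1) s''
  | ite_true {a b p q s t s'} : a.eval s.mem < b.eval s.mem → Exec elem p s t s' →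
      Exec elem (.ite a b p q) s (a.cost + b.cost + t + 1) s'
  | ite_false {a b p q s t s'} : ¬ a.eval s.mem < b.eval s.mem → Exec elem q s t s' →
      Exec elem (.ite a b p q) s (a.cost + b.cost + t + 1) s'
  | while_true {a b p s t s' t' s''} : a.eval s.mem < b.eval s.mem → Exec elem p s t s' →
      Exec elem (.while a b p) s' t' s'' →
      Exec elem (.while a b p) s (a.cost + b.cost + t + t' + 1) s''
  | while_false {a b p s} : ¬ a.eval s.mem < b.eval s.mem →
      Exec elem (.while a b p) s (a.cost + b.cost + 1) s

/-- The initial state on the input `n, m, δ, k` and the base sets: these four numbers are in the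
cells `0, 1, 2, 3`, the cell `4 + r` holds the number of the base set of the variable `x r`, and
everything else is `0`. -/
def initState (K : Type*) [Field K] {n m : ℕ} (δ k : ℕ) (base : Fin n → Fin m) : State K where
  mem a :=
    if a = 0 then n else if a = 1 then m else if a = 2 then δ else if a = 3 then k
    else if h : a - 4 < n then (base ⟨a - 4, h⟩ : ℕ) else 0
  fmem _ := 0
  out := []

/-- Started on the given input, the program `p` halts after exactly `t` steps, having written
the points of the list `H`, coordinate by coordinate. -/
def Prints {K : Type*} [Field K] (elem : ℕ → K) (p : Prog) {n m : ℕ} (δ k : ℕ)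
    (base : Fin n → Fin m) (t : ℕ) (H : List (Fin n → K)) : Prop :=
  ∃ s : State K, Exec elem p (initState K δ k base) t s ∧ s.out = H.flatMap List.ofFn


end FieldRAM

/-!
Dually, concentration says that a combination `p` of the shifted product gates, with coefficients
polynomials in the shift variables, vanishes once its coefficients at all small sets of variables
do. The base sets are treated one at a time, the shifts of the others being absorbed into the
constants of the linear forms.

For one base set, let `l = ⌈log₂ (k + 1)⌉` and suppose that `p ≠ 0` has only monomials with at
least `l` and at most `δ * l` variables. Undoing the shift of the multilinear `p` produces at least
`2 ^ l` coefficients, as many as the minimum distance of a Reed–Muller code, and at the top power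
of `t` the distinctness of the sums of the `w r` gives them distinct degrees in `t`. They are thus
linearly independent over the field, but lie in the span of the `k < 2 ^ l` coefficients of the
combination.

For an arbitrary `p` without small monomials, take the last `q` such that every block of the join
of the first `q` partitions contains at most `δ` variables of each monomial of `p`. Some monomial
then contains a set of at most `δ + 1` variables of which each later gate has two in one factor;
such a gate contributes nothing to the monomials containing that set. The other gates factor along
the blocks of the join, so the coefficients of `p` at the supersets of a suitable anchor are those
of a combination of subproducts, which has only monomials of the size treated before.

For the hitting set, `w r` is `2 ^ r` modulo a small number `q`, and a nonzero coefficient at a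
small set gives a subset `S` such that the circuit is nonzero at the point with coordinates
`t b ^ w r + [r ∈ S]`. The points run over all `q`, all `S` and all values of the `t b` in the list.
-/

/-! ### Read-once products of affine forms -/

namespace ReadOnceProduct

open MvPolynomial

section SetCoeff

variable {A σ : Type*} [CommSemiring A]

/-- The coefficient of the multilinear monomial `∏ r ∈ S, x r`, as a linear form. -/
noncomputable def setCoeff (S : Finset σ) : MvPolynomial σ A →ₗ[A] A :=
  lcoeff A (∑ r ∈ S, Finsupp.single r 1)

theorem setCoeff_apply (S : Finset σ) (p : MvPolynomial σ A) :
    setCoeff S p = p.coeff (∑ r ∈ S, Finsupp.single r 1) := rfl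

theorem sum_single_one_apply [DecidableEq σ] (S : Finset σ) (r : σ) :
    (∑ s ∈ S, Finsupp.single s 1 : σ →₀ ℕ) r = if r ∈ S then 1 else 0 := by
  simp [Finsupp.finsetSum_apply, Finsupp.single_apply]

theorem sum_single_one_injective :
    Function.Injective fun S : Finset σ => (∑ r ∈ S, Finsupp.single r 1 : σ →₀ ℕ) := by
  classical
  intro S T h
  ext r
  have hr := DFunLike.congr_fun h r
  simp only [sum_single_one_apply] at hr
  split_ifs at hr <;> simp_all

theorem prod_X_eq_monomial (S : Finset σ) :
    ∏ r ∈ S, (X r : MvPolynomial σ A) = monomial (∑ r ∈ S, Finsupp.single r 1) 1 := by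
  rw [monomial_sum_one]
  rfl

theorem setCoeff_prod_X [DecidableEq σ] (S T : Finset σ) :
    setCoeff S (∏ r ∈ T, (X r : MvPolynomial σ A)) = if T = S then 1 else 0 := by
  rw [prod_X_eq_monomial, setCoeff_apply, coeff_monomial]
  exact if_congr sum_single_one_injective.eq_iff rfl rfl

theorem setCoeff_map {A' : Type*} [CommSemiring A'] (f : A →+* A') (S : Finset σ)
    (p : MvPolynomial σ A) : setCoeff S (map f p) = f (setCoeff S p) :=
  coeff_map f p _

theorem setCoeff_X_mul [DecidableEq σ] (S : Finset σ) (r : σ) (p : MvPolynomial σ A) :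
    setCoeff S (X r * p) = if r ∈ S then setCoeff (S.erase r) p else 0 := by
  have hmem : r ∈ (∑ s ∈ S, Finsupp.single s 1 : σ →₀ ℕ).support ↔ r ∈ S := by
    simp [sum_single_one_apply]
  simp only [setCoeff_apply, coeff_X_mul', hmem]
  refine ite_congr rfl (fun h => ?_) fun _ => rfl
  rw [← Finset.add_sum_erase _ _ h, add_tsub_cancel_left]

theorem eq_sum_setCoeff_of_mem_restrictDegree [Fintype σ] {p : MvPolynomial σ A}
    (hp : p ∈ restrictDegree σ A 1) : p = ∑ S : Finset σ, setCoeff S p • ∏ r ∈ S, X r := by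
  classical
  ext m
  simp only [coeff_sum, coeff_smul, prod_X_eq_monomial, coeff_monomial, smul_eq_mul, mul_ite,
    mul_one, mul_zero]
  by_cases hm : ∃ S : Finset σ, (∑ r ∈ S, Finsupp.single r 1 : σ →₀ ℕ) = m
  · obtain ⟨S, rfl⟩ := hm
    simp [sum_single_one_injective.eq_iff, setCoeff_apply]
  · rw [Finset.sum_eq_zero fun S _ => if_neg fun e => hm ⟨S, e⟩]
    by_contra hne
    refine hm ⟨m.support, Finsupp.ext fun r => ?_⟩
    have hle := (mem_restrictDegree _ _ _).1 hp m (mem_support_iff.2 hne) r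
    rw [sum_single_one_apply]
    split_ifs with hr
    · rw [Finsupp.mem_support_iff] at hr
      omega
    · exact (Finsupp.notMem_support_iff.1 hr).symm

theorem exists_setCoeff_ne_zero_of_mem_restrictDegree [Finite σ] {p : MvPolynomial σ A}
    (hp : p ∈ restrictDegree σ A 1) (hne : p ≠ 0) : ∃ S, setCoeff S p ≠ 0 := by
  have := Fintype.ofFinite σ
  by_contra! h
  exact hne (by simpa [h] using eq_sum_setCoeff_of_mem_restrictDegree hp)

end SetCoeff

section AffineForm

variable {A σ : Type*} [CommSemiring A] [Fintype σ]

/-- The affine form `u + ∑ r, β r * x r`. -/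
noncomputable def affineForm (u : A) (β : σ → A) : MvPolynomial σ A :=
  C u + ∑ r, β r • X r

theorem map_affineForm {A' : Type*} [CommSemiring A'] (f : A →+* A') (u : A) (β : σ → A) :
    map f (affineForm u β) = affineForm (f u) fun r => f (β r) := by
  simp [affineForm, smul_eq_C_mul]

theorem setCoeff_affineForm_mul [DecidableEq σ] (S : Finset σ) (u : A) (β : σ → A)
    (p : MvPolynomial σ A) :
    setCoeff S (affineForm u β * p) =
      u * setCoeff S p + ∑ r ∈ S, β r * setCoeff (S.erase r) p := by
  have hexpand : affineForm u β * p = u • p + ∑ r, β r • (X r * p) := by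
    simp only [affineForm, add_mul, Finset.sum_mul, smul_mul_assoc, C_mul']
  simp only [hexpand, map_add, map_smul, map_sum, setCoeff_X_mul, smul_eq_mul, mul_ite, mul_zero,
    Finset.sum_ite_mem, Finset.univ_inter]

theorem degreeOf_affineForm_le [DecidableEq A] (u : A) (β : σ → A) (r : σ) :
    (affineForm u β).degreeOf r ≤ if β r = 0 then 0 else 1 := by
  classical
  refine (degreeOf_add_le _ _ _).trans (max_le (by simp) ?_)
  refine (degreeOf_sum_le _ _ _).trans (Finset.sup_le fun s _ => ?_)
  rw [smul_eq_C_mul]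
  obtain rfl | hne := eq_or_ne s r
  · split_ifs with hβ
    · simp [hβ]
    · have : Nontrivial A := ⟨_, _, hβ⟩
      exact (degreeOf_C_mul_le _ _ _).trans (by simp)
  · exact (degreeOf_C_mul_le _ _ _).trans (by simp [degreeOf_X_of_ne hne.symm])

end AffineForm

section Product

variable {A σ ι : Type*} [CommSemiring A] {J J' : Finset ι} {u : ι → A} {β : ι → σ → A}

/-- Every variable occurs in at most one of the affine forms with coefficients `β j`, `j ∈ J`. -/
def ReadOnce (J : Finset ι) (β : ι → σ → A) : Prop :=
  ∀ j ∈ J, ∀ j' ∈ J, ∀ r, β j r ≠ 0 → β j' r ≠ 0 → j = j'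

theorem ReadOnce.mono (h : ReadOnce J β) (hJ : J' ⊆ J) : ReadOnce J' β :=
  fun j hj j' hj' => h j (hJ hj) j' (hJ hj')

theorem ReadOnce.map {A' : Type*} [CommSemiring A'] (h : ReadOnce J β) (f : A →+* A') :
    ReadOnce J fun j r => f (β j r) :=
  fun j hj j' hj' r hr hr' => h j hj j' hj' r (ne_zero_of_map hr) (ne_zero_of_map hr')

variable [Fintype σ]

theorem ReadOnce.prod_mem_restrictDegree (h : ReadOnce J β) :
    ∏ j ∈ J, affineForm (u j) (β j) ∈ restrictDegree σ A 1 := by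
  classical
  simp only [mem_restrictDegree]
  suffices hdeg : ∀ r, (∏ j ∈ J, affineForm (u j) (β j)).degreeOf r ≤ 1 from
    fun s hs r => degreeOf_le_iff.1 (hdeg r) s hs
  intro r
  refine (degreeOf_prod_le r J _).trans
    ((Finset.sum_le_sum fun j _ => degreeOf_affineForm_le (u j) (β j) r).trans ?_)
  simp only [← ite_not (β _ r = 0), ← Finset.card_filter]
  refine Finset.card_le_one.2 fun j hj j' hj' => ?_
  rw [Finset.mem_filter] at hj hj'
  exact h j hj.1 j' hj'.1 r hj.2 hj'.2

theorem setCoeff_prod_eq_zero_of_absent {S : Finset σ} {r : σ} (hr : r ∈ S)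
    (h : ∀ j ∈ J, β j r = 0) : setCoeff S (∏ j ∈ J, affineForm (u j) (β j)) = 0 := by
  classical
  have hdeg : (∏ j ∈ J, affineForm (u j) (β j)).degreeOf r ≤ 0 :=
    (degreeOf_prod_le r J _).trans (Finset.sum_nonpos fun j hj =>
      (degreeOf_affineForm_le (u j) (β j) r).trans (by simp [h j hj]))
  by_contra hne
  simpa [sum_single_one_apply, hr] using degreeOf_le_iff.1 hdeg _ (mem_support_iff.2 hne)

theorem setCoeff_prod_mul_of_absent {T : Finset σ} (h : ∀ j ∈ J, ∀ r ∈ T, β j r = 0)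
    (p : MvPolynomial σ A) :
    setCoeff T ((∏ j ∈ J, affineForm (u j) (β j)) * p) = (∏ j ∈ J, u j) * setCoeff T p := by
  classical
  induction J using Finset.induction_on with
  | empty => simp
  | insert a J ha ih =>
    rw [Finset.prod_insert ha, Finset.prod_insert ha, mul_assoc, setCoeff_affineForm_mul,
      ih fun j hj => h j (Finset.mem_insert_of_mem hj), mul_assoc, Finset.sum_eq_zero, add_zero]
    exact fun r hr => by rw [h a (Finset.mem_insert_self a J) r hr, zero_mul]

theorem setCoeff_insert_prod [DecidableEq σ] [DecidableEq ι] {j : ι} (hj : j ∈ J) {z : σ}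
    {T : Finset σ} (hz : z ∉ T) (h : ∀ j' ∈ J.erase j, β j' z = 0) :
    setCoeff (insert z T) (∏ j ∈ J, affineForm (u j) (β j)) =
      β j z * setCoeff T (∏ j ∈ J.erase j, affineForm (u j) (β j)) := by
  rw [← Finset.mul_prod_erase _ _ hj, setCoeff_affineForm_mul,
    setCoeff_prod_eq_zero_of_absent (Finset.mem_insert_self z T) h, mul_zero, zero_add,
    Finset.sum_insert hz, Finset.erase_insert hz, Finset.sum_eq_zero, add_zero]
  intro r hr
  have hz' : z ∈ (insert z T).erase r :=
    Finset.mem_erase.2 ⟨fun e => hz (e ▸ hr), Finset.mem_insert_self z T⟩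
  rw [setCoeff_prod_eq_zero_of_absent hz' h, mul_zero]

/-- The scalar collects a coefficient from each factor meeting `Z` and the constant of each factor
meeting neither `Z` nor `U`. -/
theorem ReadOnce.exists_setCoeff_union_eq [DecidableEq σ] (h : ReadOnce J β) (Z U : Finset σ) :
    ∃ ε : A, ∃ J' ⊆ J, (∀ j ∈ J', (∀ r ∈ Z, β j r = 0) ∧ ∃ r ∈ U, β j r ≠ 0) ∧
      ∀ T ⊆ U, Disjoint Z T → setCoeff (Z ∪ T) (∏ j ∈ J, affineForm (u j) (β j)) =
        ε * setCoeff T (∏ j ∈ J', affineForm (u j) (β j)) := by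
  classical
  induction Z using Finset.induction_on generalizing J with
  | empty =>
    refine ⟨∏ j ∈ J with ¬ ∃ r ∈ U, β j r ≠ 0, u j, J.filter fun j => ∃ r ∈ U, β j r ≠ 0,
      Finset.filter_subset _ _, fun j hj => ⟨by simp, (Finset.mem_filter.1 hj).2⟩,
      fun T hT _ => ?_⟩
    rw [Finset.empty_union, ← Finset.prod_filter_not_mul_prod_filter J fun j => ∃ r ∈ U, β j r ≠ 0,
      setCoeff_prod_mul_of_absent]
    intro j hj r hr
    by_contra hne
    exact (Finset.mem_filter.1 hj).2 ⟨r, hT hr, hne⟩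
  | insert z Z hz ih =>
    by_cases hpresent : ∃ j ∈ J, β j z ≠ 0
    · obtain ⟨j, hj, hjz⟩ := hpresent
      have habsent : ∀ j' ∈ J.erase j, β j' z = 0 := fun j' hj' => by_contra fun hne =>
        Finset.ne_of_mem_erase hj' (h j' (Finset.mem_of_mem_erase hj') j hj z hne hjz)
      obtain ⟨ε, J', hJ', hmem, hε⟩ := ih (h.mono (J.erase_subset j))
      refine ⟨β j z * ε, J', hJ'.trans (J.erase_subset j), fun j' hj' =>
        ⟨Finset.forall_mem_insert _ _ _ |>.2 ⟨habsent j' (hJ' hj'), (hmem j' hj').1⟩,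
          (hmem j' hj').2⟩, fun T hT hZT => ?_⟩
      rw [Finset.disjoint_insert_left] at hZT
      rw [Finset.insert_union, setCoeff_insert_prod hj (by simp [hz, hZT.1]) habsent,
        hε T hT hZT.2, mul_assoc]
    · push Not at hpresent
      refine ⟨0, ∅, J.empty_subset, by simp, fun T _ _ => ?_⟩
      rw [zero_mul, setCoeff_prod_eq_zero_of_absent (r := z) (by simp) hpresent]

theorem ReadOnce.setCoeff_prod_eq_zero_of_two (h : ReadOnce J β) {S : Finset σ} {r r' : σ}
    (hr : r ∈ S) (hr' : r' ∈ S) (hne : r ≠ r') (hJ : ∀ j ∈ J, β j r' ≠ 0 → β j r ≠ 0) :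
    setCoeff S (∏ j ∈ J, affineForm (u j) (β j)) = 0 := by
  classical
  obtain ⟨ε, J', hJ', hmem, hε⟩ := h.exists_setCoeff_union_eq (u := u) {r} Finset.univ
  have habsent : ∀ j ∈ J', β j r' = 0 := fun j hj => by_contra fun hb =>
    hJ j (hJ' hj) hb ((hmem j hj).1 r (Finset.mem_singleton_self r))
  rw [← Finset.insert_erase hr, Finset.insert_eq, hε _ (Finset.subset_univ _) (by simp),
    setCoeff_prod_eq_zero_of_absent (Finset.mem_erase.2 ⟨hne.symm, hr'⟩) habsent, mul_zero]

end Product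

end ReadOnceProduct

/-! ### Translations of multilinear polynomials -/

namespace ReadOnceProduct

section Count

variable {α G : Type*} [Fintype α] [DecidableEq α] [AddCommGroup G]

theorem sum_neg_one_pow_smul_sum_superset (e : Finset α → G) (A S : Finset α) :
    ∑ B ∈ Sᶜ.powerset, (-1 : ℤ) ^ B.card • ∑ T with A ∪ B ⊆ T, e T =
      ∑ T with A ⊆ T ∧ T ⊆ S, e T := by
  simp only [Finset.sum_filter, Finset.smul_sum, smul_ite, smul_zero]
  rw [Finset.sum_comm]
  refine Finset.sum_congr rfl fun T _ => ?_
  have hfilter : {B ∈ Sᶜ.powerset | A ∪ B ⊆ T} = if A ⊆ T then (T \ S).powerset else ∅ := by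
    ext B
    split_ifs with hAT <;>
      simp [Finset.union_subset_iff, hAT, Finset.subset_sdiff, and_comm,
        Finset.subset_compl_iff_disjoint_right]
  rw [← Finset.sum_filter, hfilter]
  by_cases hAT : A ⊆ T
  · simp [hAT, ← Finset.sum_smul, Finset.sum_powerset_neg_one_pow_card]
  · simp [hAT]

/-- The lower bound on the number of monomials of `p (x + 1)` for a multilinear `p ≠ 0`, as for the
minimum distance of Reed–Muller codes: a minimal monomial `S` of `p` is recovered by inclusion and
exclusion from the coefficients at the sets that agree with a given `A ⊆ S` on `S`. -/
theorem two_pow_le_card_sum_superset_ne_zero [DecidableEq G] {d : ℕ} {e : Finset α → G}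
    (hd : ∀ S, e S ≠ 0 → d ≤ S.card) (he : e ≠ 0) :
    2 ^ d ≤ (Finset.univ.filter fun S => ∑ T with S ⊆ T, e T ≠ 0).card := by
  obtain ⟨S, hS⟩ : ∃ S, Minimal (fun S => e S ≠ 0) S :=
    exists_minimal_of_wellFoundedLT _ (Function.ne_iff.1 he)
  have hex : ∀ A ∈ S.powerset, ∃ B ⊆ Sᶜ, ∑ T with A ∪ B ⊆ T, e T ≠ 0 := by
    intro A hA
    rw [Finset.mem_powerset] at hA
    have hsum : ∑ T with A ⊆ T ∧ T ⊆ S, e T = e S := by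
      refine Finset.sum_eq_single_of_mem S (by simpa using hA) fun T hT hne => ?_
      by_contra hT0
      exact hne (hS.eq_of_ge hT0 (Finset.mem_filter.1 hT).2.2).symm
    rw [← sum_neg_one_pow_smul_sum_superset e A S] at hsum
    obtain ⟨B, hB, hne⟩ := Finset.exists_ne_zero_of_sum_ne_zero (hsum.trans_ne hS.1)
    exact ⟨B, Finset.mem_powerset.1 hB, right_ne_zero_of_smul hne⟩
  choose! B hBS hB using hex
  have hinter : ∀ A ∈ S.powerset, S ∩ (A ∪ B A) = A := fun A hA => by
    rw [Finset.inter_union_distrib_left, Finset.inter_eq_right.2 (Finset.mem_powerset.1 hA),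
      Finset.disjoint_iff_inter_eq_empty.1
        (Finset.subset_compl_iff_disjoint_left.1 (hBS A hA)), Finset.union_empty]
  calc 2 ^ d ≤ 2 ^ S.card := Nat.pow_le_pow_right two_pos (hd S hS.1)
    _ = S.powerset.card := (Finset.card_powerset S).symm
    _ ≤ _ := Finset.card_le_card_of_injOn (fun A => A ∪ B A) (fun A hA => by simpa using hB A hA)
        fun A hA A' hA' h =>
          (hinter A hA).symm.trans ((congrArg (S ∩ ·) h).trans (hinter A' hA'))

end Count

section Translate

open MvPolynomial

variable {A σ : Type*} [CommRing A]

/-- The substitution of `x r + b r` for every variable `x r`. -/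
noncomputable def shiftVars (b : σ → A) : MvPolynomial σ A →ₐ[A] MvPolynomial σ A :=
  aeval fun r => X r + C (b r)

theorem shiftVars_neg_shiftVars (b : σ → A) (p : MvPolynomial σ A) :
    shiftVars (-b) (shiftVars b p) = p := by
  have hcomp : (shiftVars (-b)).comp (shiftVars b) = AlgHom.id A (MvPolynomial σ A) := by
    ext r : 1
    simp [shiftVars]
  exact DFunLike.congr_fun hcomp p

variable [Fintype σ]

theorem shiftVars_affineForm (b : σ → A) (u : A) (β : σ → A) :
    shiftVars b (affineForm u β) = affineForm (u + ∑ r, β r * b r) β := by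
  simp only [shiftVars, affineForm, map_add, map_sum, map_mul, aeval_X, algHom_C, algebraMap_eq,
    smul_eq_C_mul, mul_add, Finset.sum_add_distrib]
  ring

variable [DecidableEq σ]

theorem prod_mul_setCoeff_shiftVars {p : MvPolynomial σ A} (hp : p ∈ restrictDegree σ A 1)
    (b : σ → A) (S : Finset σ) :
    (∏ r ∈ S, b r) * setCoeff S (shiftVars b p) =
      ∑ T with S ⊆ T, setCoeff T p * ∏ r ∈ T, b r := by
  have hprod : ∀ T : Finset σ, (∏ r ∈ S, b r) * setCoeff S (∏ r ∈ T, (X r + C (b r))) =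
      if S ⊆ T then ∏ r ∈ T, b r else 0 := by
    intro T
    simp only [Finset.prod_add, map_sum, ← map_prod, mul_comm _ (C _), ← smul_eq_C_mul, map_smul,
      setCoeff_prod_X, smul_eq_mul, mul_ite, mul_one, mul_zero, Finset.sum_ite_eq',
      Finset.mem_powerset]
    exact ite_congr rfl (fun h => (mul_comm _ _).trans (Finset.prod_sdiff h)) fun _ => rfl
  conv_lhs => rw [eq_sum_setCoeff_of_mem_restrictDegree hp]
  simp only [shiftVars, map_sum, map_smul, map_prod, aeval_X, Finset.mul_sum, smul_eq_mul,
    Finset.sum_filter]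
  refine Finset.sum_congr rfl fun T _ => ?_
  rw [mul_left_comm, hprod, mul_ite, mul_zero]

end Translate

section Rank

open Polynomial

theorem exists_two_pow_le_card_coeff_sum_superset_ne_zero {R σ : Type*} [Ring R] [DecidableEq R]
    [Fintype σ] [DecidableEq σ] {d : ℕ} {e : Finset σ → R[X]}
    (hd : ∀ S, e S ≠ 0 → d ≤ S.card) (he : e ≠ 0) :
    ∃ v, (∀ T, (e T).natDegree ≤ v) ∧
      2 ^ d ≤ (Finset.univ.filter fun S => (∑ T with S ⊆ T, e T).coeff v ≠ 0).card := by
  obtain ⟨T, hT, hmax⟩ := Finset.exists_max_image (Finset.univ.filter fun T => e T ≠ 0)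
    (fun T => (e T).natDegree) (by simpa [Finset.Nonempty] using Function.ne_iff.1 he)
  refine ⟨(e T).natDegree, fun S => ?_, ?_⟩
  · by_cases hS : e S = 0
    · simp [hS]
    · exact hmax S (by simpa using hS)
  · simp only [finsetSum_coeff]
    refine two_pow_le_card_sum_superset_ne_zero
      (fun S hS => hd S fun h0 => hS (by rw [h0, coeff_zero])) (Function.ne_iff.2 ⟨T, ?_⟩)
    exact leadingCoeff_ne_zero.2 (Finset.mem_filter.1 hT).2

variable {R : Type*} [CommRing R] [IsDomain R]

theorem linearIndependent_of_injective_natDegree {ι : Type*} {g : ι → R[X]} (hg : ∀ i, g i ≠ 0)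
    (hinj : Function.Injective fun i => (g i).natDegree) : LinearIndependent R g := by
  refine linearIndependent_iff'.2 fun s l hl i hi => ?_
  have hpairwise : Set.Pairwise {j | j ∈ s ∧ l j • g j ≠ 0}
      (Function.onFun Ne fun j => (l j • g j).degree) := by
    rintro j ⟨-, hj⟩ j' ⟨-, hj'⟩ hne heq
    dsimp only at heq
    rw [degree_smul_of_smul_regular _ (IsSMulRegular.of_ne_zero (left_ne_zero_of_smul hj)),
      degree_smul_of_smul_regular _ (IsSMulRegular.of_ne_zero (left_ne_zero_of_smul hj'))] at heq
    exact hne (hinj (natDegree_eq_of_degree_eq heq))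
  have hdeg := degree_sum_eq_of_disjoint (fun j => l j • g j) s hpairwise
  rw [hl, degree_zero, eq_comm, Finset.sup_eq_bot_iff] at hdeg
  exact (smul_eq_zero.1 (degree_eq_bot.1 (hdeg i hi))).resolve_right (hg i)

theorem card_le_of_injective_natDegree {α ι : Type*} [Fintype α] [Fintype ι] (κ : ι → R[X])
    (D : α → ι → R) (hne : ∀ a, ∑ i, D a i • κ i ≠ 0)
    (hinj : Function.Injective fun a => (∑ i, D a i • κ i).natDegree) :
    Fintype.card α ≤ Fintype.card ι := by
  have hli : LinearIndependent R D :=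
    LinearIndependent.of_comp (Fintype.linearCombination R κ)
      (linearIndependent_of_injective_natDegree hne hinj)
  simpa using hli.fintype_card_le_finrank

theorem natDegree_add_natDegree_eq_of_coeff_mul_ne_zero {a g : R[X]} {v : ℕ}
    (hle : (a * g).natDegree ≤ v) (hv : (a * g).coeff v ≠ 0) :
    g ≠ 0 ∧ a.natDegree + g.natDegree = v := by
  have hne : a * g ≠ 0 := fun h0 => hv (by rw [h0, coeff_zero])
  rw [← natDegree_mul (left_ne_zero_of_mul hne) (right_ne_zero_of_mul hne)]
  exact ⟨right_ne_zero_of_mul hne, hle.antisymm (le_natDegree_of_ne_zero hv)⟩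

variable {σ : Type*}

theorem prod_neg_X_pow_ne_zero (w : σ → ℕ) (S : Finset σ) : ∏ r ∈ S, -(X : R[X]) ^ w r ≠ 0 :=
  Finset.prod_ne_zero_iff.2 fun _ _ => neg_ne_zero.2 (pow_ne_zero _ X_ne_zero)

theorem natDegree_prod_neg_X_pow (w : σ → ℕ) (S : Finset σ) :
    (∏ r ∈ S, -(X : R[X]) ^ w r).natDegree = ∑ r ∈ S, w r := by
  rw [natDegree_prod _ _ fun r _ => neg_ne_zero.2 (pow_ne_zero _ X_ne_zero)]
  simp

/-- Otherwise, at the highest power of `X` that occurs in `p` after the substitution of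
`-X ^ w r * (x r + 1)` for `x r`, at least `2 ^ d` monomials occur; by the choice of that power,
the corresponding coefficients of the combination have distinct degrees. -/
theorem eq_zero_of_shiftVars_eq_sum [Finite σ] {ι : Type*} [Fintype ι] {d : ℕ}
    (hι : Fintype.card ι < 2 ^ d) {w : σ → ℕ} {p : MvPolynomial σ R[X]}
    (hp : p ∈ MvPolynomial.restrictDegree σ R[X] 1) {κ : ι → R[X]} {D : ι → MvPolynomial σ R}
    (hshift : shiftVars (fun r => -(X : R[X]) ^ w r) p =
      ∑ i, κ i • MvPolynomial.map C (D i))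
    (hd : ∀ T, setCoeff T p ≠ 0 → d ≤ T.card)
    (hw : Set.InjOn (fun S => ∑ r ∈ S, w r) {S | ∃ T, S ⊆ T ∧ setCoeff T p ≠ 0}) : p = 0 := by
  classical
  have := Fintype.ofFinite σ
  by_contra hne
  set e : Finset σ → R[X] := fun T => setCoeff T p * ∏ r ∈ T, -(X : R[X]) ^ w r
  have he : ∀ T, e T ≠ 0 ↔ setCoeff T p ≠ 0 := fun T => by
    simp only [e, ne_eq, mul_eq_zero, prod_neg_X_pow_ne_zero, or_false]
  set g : Finset σ → R[X] := fun S => ∑ i, setCoeff S (D i) • κ i with hg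
  have hsum : ∀ S, ∑ T with S ⊆ T, e T = (∏ r ∈ S, -(X : R[X]) ^ w r) * g S := fun S => by
    simp only [e, hg, ← prod_mul_setCoeff_shiftVars hp, hshift, map_sum, map_smul,
      setCoeff_map, smul_eq_mul, smul_eq_C_mul, mul_comm (κ _)]
  obtain ⟨T, hT⟩ := exists_setCoeff_ne_zero_of_mem_restrictDegree hp hne
  obtain ⟨v, hv, hcard⟩ := exists_two_pow_le_card_coeff_sum_superset_ne_zero
    (fun S hS => hd S ((he S).1 hS)) (Function.ne_iff.2 ⟨T, (he T).2 hT⟩)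
  set 𝒯 := Finset.univ.filter fun S => (∑ T with S ⊆ T, e T).coeff v ≠ 0
  have hdeg : ∀ S ∈ 𝒯, g S ≠ 0 ∧ ∑ r ∈ S, w r + (g S).natDegree = v := fun S hS => by
    rw [← natDegree_prod_neg_X_pow (R := R)]
    refine natDegree_add_natDegree_eq_of_coeff_mul_ne_zero ?_ (hsum S ▸ (Finset.mem_filter.1 hS).2)
    exact hsum S ▸ natDegree_sum_le_of_forall_le _ _ fun T _ => hv T
  have hsub : ∀ S ∈ 𝒯, ∃ T, S ⊆ T ∧ setCoeff T p ≠ 0 := fun S hS => by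
    have hcoeff := (Finset.mem_filter.1 hS).2
    rw [finsetSum_coeff] at hcoeff
    obtain ⟨T, hST, hT⟩ := Finset.exists_ne_zero_of_sum_ne_zero hcoeff
    exact ⟨T, (Finset.mem_filter.1 hST).2, (he T).1 fun h0 => hT (by rw [h0, coeff_zero])⟩
  have hrank := card_le_of_injective_natDegree κ (fun (S : 𝒯) i => setCoeff S.1 (D i))
    (fun S => (hdeg S S.2).1) fun S S' heq => Subtype.ext <| hw (hsub S S.2) (hsub S' S'.2) <|
      Nat.add_right_cancel <|
        ((hdeg S S.2).2.trans (hdeg S' S'.2).2.symm).trans (congrArg (_ + ·) heq.symm)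
  rw [Fintype.card_coe] at hrank
  omega

end Rank

end ReadOnceProduct

/-! ### Partition sequences of small distance -/

section Partition

variable {n k δ : ℕ} {P : Fin k → Finpartition (Finset.univ : Finset (Fin n))}

theorem mem_sup_id_iff_part_mem {P : Finpartition (Finset.univ : Finset (Fin n))}
    {N : Finset (Finset (Fin n))} (hN : N ⊆ P.parts) {a : Fin n} :
    a ∈ N.sup id ↔ P.part a ∈ N := by
  rw [Finset.mem_sup]
  refine ⟨fun ⟨Y, hY, haY⟩ => ?_, fun h => ⟨_, h, P.mem_part (Finset.mem_univ a)⟩⟩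
  rwa [P.part_eq_of_mem (hN hY) haY]

/-- The finest partition that is coarser than the partitions `P i` with `i < q`. -/
def joinSetoid (P : Fin k → Finpartition (Finset.univ : Finset (Fin n))) (q : ℕ) :
    Setoid (Fin n) :=
  Relation.EqvGen.setoid fun a b => ∃ i : Fin k, (i : ℕ) < q ∧ (P i).part a = (P i).part b

theorem joinSetoid_mono {q q' : ℕ} (h : q ≤ q') {a b : Fin n} (hab : joinSetoid P q a b) :
    joinSetoid P q' a b :=
  Relation.EqvGen.mono (fun _ _ ⟨i, hi, e⟩ => ⟨i, hi.trans_le h, e⟩) _ _ hab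

theorem apply_eq_of_joinSetoid {α : Type*} {q : ℕ} {f : Fin n → α}
    (hf : ∀ i : Fin k, (i : ℕ) < q → ∀ a b, (P i).part a = (P i).part b → f a = f b)
    {a b : Fin n} (hab : joinSetoid P q a b) : f a = f b := by
  induction hab with
  | rel a b h =>
    obtain ⟨i, hi, e⟩ := h
    exact hf i hi a b e
  | refl => rfl
  | symm _ _ _ ih => exact ih.symm
  | trans _ _ _ _ _ ih ih' => exact ih.trans ih'

theorem PartitionDistLE.exists_cover_of_joinSetoid (hP : PartitionDistLE P δ) (hδ : 1 ≤ δ)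
    (i : Fin k) (a : Fin n) :
    ∃ N : Finset (Finset (Fin n)), N.card ≤ δ ∧
      ∀ b, joinSetoid P (i + 1) a b → (P i).part b ∈ N := by
  obtain ⟨N, hN, haN, hcard, hearlier⟩ : ∃ N ⊆ (P i).parts, (P i).part a ∈ N ∧ N.card ≤ δ ∧
      ∀ j < i, ∃ Z ⊆ (P j).parts, Z.sup id = N.sup id := by
    rcases Nat.eq_zero_or_pos (i : ℕ) with hi | hi
    · exact ⟨{(P i).part a}, by simp, by simp, by simpa using hδ,
        fun j hj => absurd (Fin.lt_def.1 hj) (by omega)⟩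
    · exact hP i hi _ ((P i).part_mem.2 (Finset.mem_univ a))
  refine ⟨N, hcard, fun b hab => ?_⟩
  have hunion : ∀ j : Fin k, (j : ℕ) < i + 1 → ∀ x y, (P j).part x = (P j).part y →
      (x ∈ N.sup id) = (y ∈ N.sup id) := by
    intro j hj x y hxy
    rcases (Nat.lt_succ_iff.1 hj).lt_or_eq with h | h
    · obtain ⟨Z, hZ, hZN⟩ := hearlier j h
      simp only [← hZN, mem_sup_id_iff_part_mem hZ, hxy]
    · obtain rfl : j = i := Fin.ext h
      simp only [mem_sup_id_iff_part_mem hN, hxy]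
  rw [← mem_sup_id_iff_part_mem hN] at haN ⊢
  exact (apply_eq_of_joinSetoid hunion hab).mp haN

theorem PartitionDistLE.exists_part_eq_of_card_lt (hP : PartitionDistLE P δ) (hδ : 1 ≤ δ)
    (i : Fin k) {a : Fin n} {R : Finset (Fin n)} (hR : ∀ b ∈ R, joinSetoid P (i + 1) a b)
    (hcard : δ < R.card) : ∃ b ∈ R, ∃ b' ∈ R, b ≠ b' ∧ (P i).part b = (P i).part b' := by
  obtain ⟨N, hN, hcover⟩ := hP.exists_cover_of_joinSetoid hδ i a
  exact Finset.exists_ne_map_eq_of_card_lt_of_maps_to (hN.trans_lt hcard)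
    fun b hb => hcover b (hR b hb)

open Classical in
/-- The level `q` is the last one at which every block of the join contains at most `δ` elements of
every member of `𝒮`; the set `Z` lies in a block of the next join. -/
theorem PartitionDistLE.exists_level (hP : PartitionDistLE P δ) (hδ : 1 ≤ δ)
    {𝒮 : Set (Finset (Fin n))} (h𝒮 : 𝒮.Nonempty) :
    ∃ (q : ℕ) (Z : Finset (Fin n)),
      (∀ S ∈ 𝒮, ∀ y : Quotient (joinSetoid P q), (S.filter fun r => ⟦r⟧ = y).card ≤ δ) ∧
      Z.card ≤ δ + 1 ∧ (∃ S ∈ 𝒮, Z ⊆ S) ∧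
      ∀ i : Fin k, q ≤ i → ∃ a ∈ Z, ∃ b ∈ Z, a ≠ b ∧ (P i).part a = (P i).part b := by
  let Thin (q : ℕ) : Prop :=
    ∀ S ∈ 𝒮, ∀ y : Quotient (joinSetoid P q), (S.filter fun r => ⟦r⟧ = y).card ≤ δ
  have hzero : Thin 0 := fun S _ y => (Finset.card_le_one.2 fun a ha b hb =>
    apply_eq_of_joinSetoid (P := P) (f := id) (fun i hi => absurd hi (Nat.not_lt_zero _))
      (Quotient.exact ((Finset.mem_filter.1 ha).2.trans (Finset.mem_filter.1 hb).2.symm))).trans hδ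
  by_cases hlast : Thin k
  · obtain ⟨S, hS⟩ := h𝒮
    exact ⟨k, ∅, hlast, by simp, ⟨S, hS, S.empty_subset⟩, fun i hi => absurd i.2 hi.not_gt⟩
  obtain ⟨q, hthin, hnext⟩ := Nat.exists_not_and_succ_of_not_zero_of_exists
    (p := fun q => ¬ Thin q) (not_not.2 hzero) ⟨k, hlast⟩
  simp only [Thin, not_forall, not_le] at hnext
  obtain ⟨S, hS, y, hcard⟩ := hnext
  obtain ⟨a, rfl⟩ := Quotient.exists_rep y
  obtain ⟨Z, hZS, hZ⟩ := Finset.exists_subset_card_eq (Nat.succ_le_of_lt hcard)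
  refine ⟨q, Z, not_not.1 hthin, hZ.le, ⟨S, hS, hZS.trans (Finset.filter_subset _ _)⟩,
    fun i hi => hP.exists_part_eq_of_card_lt hδ i (a := a) (fun b hb => ?_) (by omega)⟩
  exact joinSetoid_mono (by omega) (Quotient.exact (Finset.mem_filter.1 (hZS hb)).2.symm)

end Partition

section Anchor

variable {σ κ : Type*} [Finite σ] [DecidableEq σ] [DecidableEq κ]

/-- `W` is chosen to leave free only few blocks of a member of `𝒮` that contains `Z` and meets as
few blocks as possible outside `Z`. -/
theorem exists_anchor (blk : σ → κ) {𝒮 : Set (Finset σ)} {l δ : ℕ} {Z : Finset σ}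
    (hthin : ∀ S ∈ 𝒮, ∀ y, (S.filter fun r => blk r = y).card ≤ δ) (hZ : Z.card ≤ δ + 1)
    (hlarge : ∀ S ∈ 𝒮, l + δ < S.card) (hex : ∃ S ∈ 𝒮, Z ⊆ S) :
    ∃ W U : Finset σ, Z ⊆ W ∧ (∀ a b, blk a = blk b → a ∈ U → b ∈ U) ∧
      (∃ T ⊆ U, Disjoint W T ∧ W ∪ T ∈ 𝒮) ∧
      ∀ T ⊆ U, Disjoint W T → W ∪ T ∈ 𝒮 → l ≤ T.card ∧ T.card ≤ δ * l := by
  classical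
  have := Fintype.ofFinite σ
  obtain ⟨S, hSmem, hmin⟩ := Finset.exists_min_image
    (Finset.univ.filter fun S : Finset σ => S ∈ 𝒮 ∧ Z ⊆ S) (fun S => ((S \ Z).image blk).card)
    (by simpa [Finset.Nonempty] using hex)
  obtain ⟨hS, hZS⟩ := (Finset.mem_filter.1 hSmem).2
  obtain ⟨𝓑, h𝓑, hcard⟩ := Finset.exists_subset_card_eq
    (min_le_left ((S \ Z).image blk).card l)
  set U : Finset σ := Finset.univ.filter fun r => blk r ∈ 𝓑
  have hU : ∀ {r}, r ∈ U ↔ blk r ∈ 𝓑 := by simp [U]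
  have hunion : Z ∪ S \ U ∪ (S ∩ U) \ Z = S := by grind
  refine ⟨Z ∪ S \ U, U, Finset.subset_union_left, fun a b hab ha => hU.2 (hab ▸ hU.1 ha),
    ⟨(S ∩ U) \ Z, by grind, by rw [Finset.disjoint_left]; grind, hunion.symm ▸ hS⟩,
    fun T hTU _ hT => ⟨?_, ?_⟩⟩
  · rcases le_or_gt l ((S \ Z).image blk).card with hl | hl
    · have himage : ((Z ∪ S \ U ∪ T) \ Z).image blk ⊆ T.image blk ∪ ((S \ Z).image blk) \ 𝓑 := by
        grind
      have hle := (hmin _ (Finset.mem_filter.2 ⟨Finset.mem_univ _, hT, by grind⟩)).trans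
        ((Finset.card_le_card himage).trans (Finset.card_union_le _ _))
      rw [Finset.card_sdiff_of_subset h𝓑] at hle
      have := Finset.card_image_le (s := T) (f := blk)
      omega
    · have h𝓑eq : 𝓑 = (S \ Z).image blk :=
        Finset.eq_of_subset_of_card_le h𝓑 (hcard.trans (min_eq_left hl.le)).ge
      have hW : Z ∪ S \ U = Z := by grind
      have := hlarge _ hT
      have := Finset.card_union_le (Z ∪ S \ U) T
      rw [hW] at *
      omega
  · calc T.card ≤ δ * 𝓑.card := Finset.card_le_mul_card_image_of_maps_to (f := blk)
          (fun r hr => hU.1 (hTU hr)) δ fun y _ => (Finset.card_le_card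
            (Finset.filter_subset_filter _ Finset.subset_union_right)).trans (hthin _ hT y)
      _ ≤ δ * l := Nat.mul_le_mul_left _ (hcard.trans_le (min_le_right _ _))

end Anchor

/-! ### Products with colored variables -/

namespace ReadOnceProduct

section Induces

variable {A σ ι α : Type*} [CommSemiring A] {J : Finset ι} {β : ι → σ → A} {π : σ → α}

/-- The coloring `π` of the variables is induced by the product of the affine forms with
coefficients `β j`, `j ∈ J`: variables that occur in the product have the same color exactly when
they occur in the same form. The colors of the other variables are arbitrary. -/
def Induces (J : Finset ι) (β : ι → σ → A) (π : σ → α) : Prop :=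
  ∀ j ∈ J, ∀ j' ∈ J, ∀ r r', β j r ≠ 0 → β j' r' ≠ 0 → (π r = π r' ↔ j = j')

theorem Induces.readOnce (h : Induces J β π) : ReadOnce J β :=
  fun j hj j' hj' r hr hr' => (h j hj j' hj' r r hr hr').1 rfl

theorem Induces.mono {J' : Finset ι} (h : Induces J β π) (hJ : J' ⊆ J) : Induces J' β π :=
  fun j hj j' hj' => h j (hJ hj) j' (hJ hj')

theorem Induces.map {A' : Type*} [CommSemiring A'] (h : Induces J β π) (f : A →+* A') :
    Induces J (fun j r => f (β j r)) π :=
  fun j hj j' hj' r r' hr hr' => h j hj j' hj' r r' (ne_zero_of_map hr) (ne_zero_of_map hr')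

variable [Fintype σ] {u : ι → A}

theorem Induces.setCoeff_prod_eq_zero (h : Induces J β π) {S : Finset σ} {r r' : σ} (hr : r ∈ S)
    (hr' : r' ∈ S) (hne : r ≠ r') (hcolor : π r = π r') :
    setCoeff S (∏ j ∈ J, affineForm (u j) (β j)) = 0 := by
  by_cases hpresent : ∃ j ∈ J, β j r ≠ 0
  · obtain ⟨j, hj, hjr⟩ := hpresent
    refine h.readOnce.setCoeff_prod_eq_zero_of_two hr hr' hne fun j' hj' hjr' => ?_
    rwa [← (h j hj j' hj' r r' hjr hjr').1 hcolor]
  · push Not at hpresent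
    exact setCoeff_prod_eq_zero_of_absent hr hpresent

theorem Induces.exists_residual [DecidableEq σ] (h : Induces J β π) {W U : Finset σ}
    (hWU : (∀ a b, π a = π b → a ∈ U → b ∈ U) ∨ ∃ a ∈ W, ∃ b ∈ W, a ≠ b ∧ π a = π b) :
    ∃ ε : A, ∃ J' ⊆ J, ∀ T, ε * setCoeff T (∏ j ∈ J', affineForm (u j) (β j)) =
      if T ⊆ U ∧ Disjoint W T then setCoeff (W ∪ T) (∏ j ∈ J, affineForm (u j) (β j)) else 0 := by
  rcases hWU with hU | ⟨a, ha, b, hb, hne, hcolor⟩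
  · obtain ⟨ε, J', hJ', hmem, hε⟩ := h.readOnce.exists_setCoeff_union_eq (u := u) W U
    refine ⟨ε, J', hJ', fun T => ?_⟩
    split_ifs with hT
    · exact (hε T hT.1 hT.2).symm
    suffices habsent : ∃ r ∈ T, ∀ j ∈ J', β j r = 0 by
      obtain ⟨r, hr, hzero⟩ := habsent
      rw [setCoeff_prod_eq_zero_of_absent hr hzero, mul_zero]
    by_contra! hall
    refine hT ⟨fun r hr => ?_, Finset.disjoint_right.2 fun r hr hrW => ?_⟩ <;>
      obtain ⟨j, hj, hjr⟩ := hall r hr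
    · obtain ⟨r', hr', hjr'⟩ := (hmem j hj).2
      exact hU r' r ((h j (hJ' hj) j (hJ' hj) r' r hjr' hjr).2 rfl) hr'
    · exact hjr ((hmem j hj).1 r hrW)
  · refine ⟨0, ∅, J.empty_subset, fun T => ?_⟩
    rw [zero_mul, h.setCoeff_prod_eq_zero (Finset.mem_union_left T ha)
      (Finset.mem_union_left T hb) hne hcolor, ite_self]

end Induces

theorem shiftVars_map_prod_affineForm {A A' σ ι : Type*} [CommRing A] [CommRing A'] [Fintype σ]
    (f : A →+* A') (b : σ → A') (J : Finset ι) (c : ι → A) (β : ι → σ → A) :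
    shiftVars b (MvPolynomial.map f (∏ j ∈ J, affineForm (c j) (β j))) =
      ∏ j ∈ J, affineForm (f (c j) + ∑ r, f (β j r) * b r) fun r => f (β j r) := by
  simp only [map_prod, map_affineForm, shiftVars_affineForm]

section OneBaseSet

open Polynomial

variable {R : Type*} [CommRing R] [IsDomain R] {n k l δ : ℕ} {ι : Fin k → Type*}
  {J : ∀ i, Finset (ι i)} {c : ∀ i, ι i → R} {β : ∀ i, ι i → Fin n → R} {w : Fin n → ℕ}
  {B : Set (Fin n)} {κ : Fin k → R[X]} {p : MvPolynomial (Fin n) R[X]}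

theorem eq_zero_of_card_mem_Icc {s : ℕ} (hread : ∀ i, ReadOnce (J i) (β i))
    (hB : ∀ i, ∀ j ∈ J i, ∀ r ∉ B, β i j r = 0)
    (hw : Set.InjOn (fun S => ∑ r ∈ S, w r) {S : Finset (Fin n) | ↑S ⊆ B ∧ S.card ≤ s})
    (hk : k < 2 ^ l)
    (hp : p = ∑ i, κ i • shiftVars (fun r => X ^ w r)
      (MvPolynomial.map C (∏ j ∈ J i, affineForm (c i j) (β i j))))
    (hcard : ∀ S, setCoeff S p ≠ 0 → S.card ∈ Set.Icc l s) : p = 0 := by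
  have hshift : shiftVars (fun r => -(X : R[X]) ^ w r) p =
      ∑ i, κ i • MvPolynomial.map C (∏ j ∈ J i, affineForm (c i j) (β i j)) := by
    simp only [hp, map_sum, map_smul]
    exact Finset.sum_congr rfl fun i _ => congrArg _ (shiftVars_neg_shiftVars (fun r => X ^ w r) _)
  simp only [shiftVars_map_prod_affineForm] at hp
  have hsub : ∀ S, setCoeff S p ≠ 0 → ↑S ⊆ B := by
    refine fun S hS r hr => by_contra fun hrB => hS ?_
    rw [hp, map_sum]
    refine Finset.sum_eq_zero fun i _ => ?_
    rw [map_smul, setCoeff_prod_eq_zero_of_absent hr, smul_zero]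
    exact fun j hj => by rw [hB i j hj r hrB, C_0]
  refine eq_zero_of_shiftVars_eq_sum (by simpa using hk) (hp ▸ sum_mem fun i _ =>
    Submodule.smul_mem _ _ ((hread i).map C).prod_mem_restrictDegree) hshift
    (fun S hS => (hcard S hS).1) (hw.mono ?_)
  rintro S ⟨T, hST, hT⟩
  exact ⟨fun r hr => hsub T hT (hST hr), (Finset.card_le_card hST).trans (hcard T hT).2⟩

/-- A nonzero `p` has a nonzero residue, at the anchor `W`, all of whose monomials have at least `l`
and at most `δ * l` variables. -/
theorem eq_zero_of_forall_card_le {P : Fin k → Finpartition (Finset.univ : Finset (Fin n))}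
    (hP : PartitionDistLE P δ) (hδ : 1 ≤ δ) (hind : ∀ i, Induces (J i) (β i) (P i).part)
    (hB : ∀ i, ∀ j ∈ J i, ∀ r ∉ B, β i j r = 0)
    (hw : Set.InjOn (fun S => ∑ r ∈ S, w r) {S : Finset (Fin n) | ↑S ⊆ B ∧ S.card ≤ δ * l})
    (hk : k < 2 ^ l)
    (hp : p = ∑ i, κ i • shiftVars (fun r => X ^ w r)
      (MvPolynomial.map C (∏ j ∈ J i, affineForm (c i j) (β i j))))
    (hlow : ∀ S : Finset (Fin n), S.card ≤ l + δ → setCoeff S p = 0) : p = 0 := by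
  classical
  by_contra hne
  obtain ⟨S, hS⟩ : ∃ S, setCoeff S p ≠ 0 := by
    simp only [shiftVars_map_prod_affineForm] at hp
    exact exists_setCoeff_ne_zero_of_mem_restrictDegree (hp ▸ sum_mem fun i _ =>
      Submodule.smul_mem _ _ ((hind i).readOnce.map C).prod_mem_restrictDegree) hne
  obtain ⟨q, Z, hthin, hZ, hex, hmono⟩ :=
    hP.exists_level hδ (𝒮 := {S | setCoeff S p ≠ 0}) ⟨S, hS⟩
  obtain ⟨W, U, hZW, hU, ⟨T, hTU, hWT, hT⟩, hcard⟩ := exists_anchor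
    (fun r => (⟦r⟧ : Quotient (joinSetoid P q))) hthin hZ
    (fun S hS => lt_of_not_ge fun hle => hS (hlow S hle)) hex
  have hresidual (i : Fin k) := ((hind i).map C).exists_residual (W := W) (U := U)
    (u := fun j => C (c i j) + ∑ r, C (β i j r) * X ^ w r) <| (lt_or_ge (i : ℕ) q).imp
      (fun hi a b hab => hU a b (Quotient.sound (Relation.EqvGen.rel a b ⟨i, hi, hab⟩)))
      (fun hi => have ⟨a, ha, b, hb, h⟩ := hmono i hi; ⟨a, hZW ha, b, hZW hb, h⟩)
  choose ε J' hJ' hε using hresidual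
  set p' := ∑ i, (κ i * ε i) • shiftVars (fun r => X ^ w r)
    (MvPolynomial.map C (∏ j ∈ J' i, affineForm (c i j) (β i j))) with hp'
  have hcoeff : ∀ S, setCoeff S p' = if S ⊆ U ∧ Disjoint W S then setCoeff (W ∪ S) p else 0 := by
    intro S
    simp only [hp', hp, shiftVars_map_prod_affineForm, map_sum, map_smul, smul_eq_mul, mul_assoc,
      hε]
    split_ifs <;> simp only [mul_zero, Finset.sum_const_zero]
  have hzero : p' = 0 := by
    refine eq_zero_of_card_mem_Icc (fun i => (hind i).readOnce.mono (hJ' i))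
      (fun i j hj => hB i j (hJ' i hj)) hw hk hp' fun S hS => ?_
    obtain ⟨⟨hSU, hWS⟩, hS⟩ := ite_ne_right_iff.1 (hcoeff S ▸ hS)
    exact hcard S hSU hWS hS
  have hcoeffT := hcoeff T
  rw [if_pos ⟨hTU, hWT⟩, hzero, map_zero] at hcoeffT
  exact hT hcoeffT.symm

end OneBaseSet

end ReadOnceProduct

/-! ### Shifted circuits -/

section SingleOut

variable {F : Type*} [CommSemiring F] {m : ℕ}

/-- The polynomials in `t 0, …, t (m - 1)` as univariate polynomials in `t b`; the coefficients are
again written as polynomials in all `m` variables. -/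
noncomputable def singleOut (b : Fin m) :
    MvPolynomial (Fin m) F →+* Polynomial (MvPolynomial (Fin m) F) :=
  MvPolynomial.eval₂Hom (Polynomial.C.comp MvPolynomial.C)
    fun b' => if b' = b then Polynomial.X else Polynomial.C (MvPolynomial.X b')

theorem singleOut_injective (b : Fin m) : Function.Injective (singleOut (F := F) b) := by
  have hcomp : (Polynomial.evalRingHom (MvPolynomial.X b)).comp (singleOut (F := F) b) =
      RingHom.id _ := by
    refine MvPolynomial.ringHom_ext (fun a => by simp [singleOut]) fun b' => ?_
    by_cases h : b' = b <;> simp [singleOut, h]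
  exact Function.LeftInverse.injective (g := Polynomial.evalRingHom (MvPolynomial.X b))
    (DFunLike.congr_fun hcomp)

end SingleOut

theorem ReadOnceProduct.setCoeff_prod_affineForm_congr {A σ ι : Type*} [CommSemiring A] [Fintype σ]
    {J : Finset ι} {u : ι → A} {β β' : ι → σ → A} {S : Finset σ}
    (h : ∀ j ∈ J, ∀ r ∈ S, β j r = β' j r) :
    setCoeff S (∏ j ∈ J, affineForm (u j) (β j)) =
      setCoeff S (∏ j ∈ J, affineForm (u j) (β' j)) := by
  classical
  induction J using Finset.induction_on generalizing S with
  | empty => simp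
  | insert a J ha ih =>
    rw [Finset.forall_mem_insert] at h
    simp only [Finset.prod_insert ha, setCoeff_affineForm_mul]
    rw [ih h.2]
    refine congrArg _ (Finset.sum_congr rfl fun r hr => ?_)
    rw [h.1 r hr, ih fun j hj r' hr' => h.2 j hj r' (Finset.mem_of_mem_erase hr')]

open ReadOnceProduct in
theorem LinForm.poly_eq_affineForm {F : Type*} [Field F] {n : ℕ} (p : LinForm F n) :
    p.poly = affineForm p.const p.coef := by
  simp only [poly, affineForm, MvPolynomial.smul_eq_C_mul]

namespace Depth3Circuit

open ReadOnceProduct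

variable {F : Type*} [Field F] {n k m δ : ℕ} {Q : Depth3Circuit F n k} {base : Fin n → Fin m}
  {w : Fin n → ℕ}

/-- The `i`-th product gate after the shift of `x r` by `t (base r) ^ w r`, as a polynomial with
coefficients in the ring of polynomials in the shift variables. -/
noncomputable def polyGate (Q : Depth3Circuit F n k) (base : Fin n → Fin m) (w : Fin n → ℕ)
    (i : Fin k) : MvPolynomial (Fin n) (MvPolynomial (Fin m) F) :=
  shiftVars (fun r => MvPolynomial.X (base r) ^ w r) (MvPolynomial.map MvPolynomial.C (Q.gate i))

theorem gate_eq_prod_affineForm (Q : Depth3Circuit F n k) (i : Fin k) :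
    Q.gate i = ∏ j, affineForm (Q.lin i j).const (Q.lin i j).coef :=
  Finset.prod_congr rfl fun j _ => (Q.lin i j).poly_eq_affineForm

theorem shiftedGate_eq_map_polyGate (i : Fin k) : Q.shiftedGate base w i =
    MvPolynomial.map (algebraMap (MvPolynomial (Fin m) F) (ShiftField F m))
      (Q.polyGate base w i) := by
  have hhom : (MvPolynomial.aeval fun r => MvPolynomial.X r + MvPolynomial.C
        (algebraMap (MvPolynomial (Fin m) F) (ShiftField F m) (MvPolynomial.X (base r) ^ w r)) :
        MvPolynomial (Fin n) F →ₐ[F] MvPolynomial (Fin n) (ShiftField F m)).toRingHom =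
      (MvPolynomial.map (algebraMap (MvPolynomial (Fin m) F) (ShiftField F m))).comp
        ((shiftVars fun r => MvPolynomial.X (base r) ^ w r).toRingHom.comp
          (MvPolynomial.map MvPolynomial.C)) := by
    refine MvPolynomial.ringHom_ext (fun a => ?_) fun r => by simp [shiftVars]
    simp only [AlgHom.toRingHom_eq_coe, RingHom.coe_coe, MvPolynomial.algHom_C, RingHom.comp_apply,
      MvPolynomial.map_C, MvPolynomial.algebraMap_eq]
    rw [IsScalarTower.algebraMap_apply F (ShiftField F m), MvPolynomial.algebraMap_eq,
      IsScalarTower.algebraMap_apply F (MvPolynomial (Fin m) F) (ShiftField F m),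
      MvPolynomial.algebraMap_eq]
  exact DFunLike.congr_fun hhom (Q.gate i)

theorem HasBaseSetsDistance.readOnce (hQ : Q.HasBaseSetsDistance base δ) (i : Fin k) :
    ReadOnce Finset.univ fun j => (Q.lin i j).coef := by
  intro j _ j' _ r hr hr'
  obtain ⟨e, P, hP, -⟩ := hQ (base r)
  obtain ⟨i, rfl⟩ := e.surjective i
  refine ((hP i) j j' r r ?_ ?_).1 rfl <;>
    simpa [restrict, LinForm.Present, LinForm.restrict] using ‹_›

theorem HasBaseSetsDistance.polyGate_mem_restrictDegree (hQ : Q.HasBaseSetsDistance base δ)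
    (w : Fin n → ℕ) (i : Fin k) :
    Q.polyGate base w i ∈ MvPolynomial.restrictDegree (Fin n) (MvPolynomial (Fin m) F) 1 := by
  rw [polyGate, gate_eq_prod_affineForm, shiftVars_map_prod_affineForm]
  exact ((hQ.readOnce i).map MvPolynomial.C).prod_mem_restrictDegree

theorem singleOut_shifted_const (p : LinForm F n) (base : Fin n → Fin m) (w : Fin n → ℕ)
    (b : Fin m) :
    singleOut b (MvPolynomial.C p.const +
      ∑ r, MvPolynomial.C (p.coef r) * MvPolynomial.X (base r) ^ w r) =
    Polynomial.C (MvPolynomial.C p.const + ∑ r with base r ≠ b,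
      MvPolynomial.C (p.coef r) * MvPolynomial.X (base r) ^ w r) +
    ∑ r, Polynomial.C (MvPolynomial.C ((p.restrict {r | base r = b}).coef r)) *
      Polynomial.X ^ w r := by
  rw [Finset.sum_filter]
  simp only [map_add, map_sum, add_assoc, ← Finset.sum_add_distrib]
  congr 1
  · simp [singleOut]
  · refine Finset.sum_congr rfl fun r _ => ?_
    by_cases hr : base r = b <;> simp [singleOut, LinForm.restrict, hr]

/-- The `j`-th factor of the `i`-th product, with the shift by the powers of `t b` left out, as a
polynomial in the variables of the base set `b`. The other variables only leave their shifts, in the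
constant coefficient. -/
noncomputable def baseForm (Q : Depth3Circuit F n k) (base : Fin n → Fin m) (w : Fin n → ℕ)
    (b : Fin m) (i : Fin k) (j : Fin (Q.fanin i)) : MvPolynomial (Fin n) (MvPolynomial (Fin m) F) :=
  affineForm
    (MvPolynomial.C (Q.lin i j).const + ∑ r with base r ≠ b,
      MvPolynomial.C ((Q.lin i j).coef r) * MvPolynomial.X (base r) ^ w r)
    fun r => MvPolynomial.C (((Q.lin i j).restrict {r | base r = b}).coef r)

theorem singleOut_setCoeff_shiftVars (Q : Depth3Circuit F n k) (base : Fin n → Fin m)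
    (w : Fin n → ℕ) (b : Fin m) (i : Fin k) (J : Finset (Fin (Q.fanin i))) {T : Finset (Fin n)}
    (hT : ∀ r ∈ T, base r = b) :
    singleOut b (setCoeff T (shiftVars (fun r => MvPolynomial.X (base r) ^ w r)
      (MvPolynomial.map MvPolynomial.C
        (∏ j ∈ J, affineForm (Q.lin i j).const (Q.lin i j).coef)))) =
    setCoeff T (shiftVars (fun r => Polynomial.X ^ w r) (MvPolynomial.map Polynomial.C
      (∏ j ∈ J, Q.baseForm base w b i j))) := by
  simp only [baseForm]
  rw [shiftVars_map_prod_affineForm, shiftVars_map_prod_affineForm, ← setCoeff_map]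
  simp only [map_prod, map_affineForm, singleOut_shifted_const]
  refine setCoeff_prod_affineForm_congr fun j _ r hr => ?_
  simp [singleOut, LinForm.restrict, hT r hr]

theorem sum_smul_shiftVars_prod_baseForm_eq_zero (hδ : 1 ≤ δ) (hQ : Q.HasBaseSetsDistance base δ)
    (hw : SeparatesBaseSets base w (δ * Nat.clog 2 (k + 1))) (b : Fin m)
    {J : ∀ i : Fin k, Finset (Fin (Q.fanin i))} {a : Fin k → Polynomial (MvPolynomial (Fin m) F)}
    {p : MvPolynomial (Fin n) (Polynomial (MvPolynomial (Fin m) F))}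
    (hp : p = ∑ i, a i • shiftVars (fun r => Polynomial.X ^ w r)
      (MvPolynomial.map Polynomial.C (∏ j ∈ J i, Q.baseForm base w b i j)))
    (hlow : ∀ T : Finset (Fin n), (∀ r ∈ T, base r = b) → T.card ≤ Nat.clog 2 (k + 1) + δ →
      setCoeff T p = 0) : p = 0 := by
  obtain ⟨e, P, hind, hP⟩ := hQ b
  have habsent (i : Fin k) (j : Fin (Q.fanin i)) (r : Fin n) (hr : r ∉ {r | base r = b}) :
      (MvPolynomial.C (((Q.lin i j).restrict {r | base r = b}).coef r) : MvPolynomial (Fin m) F) =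
        0 := (congrArg MvPolynomial.C (if_neg hr)).trans (map_zero _)
  refine eq_zero_of_forall_card_le hP hδ
    (fun i => (Induces.map (fun j _ j' _ => hind i j j') MvPolynomial.C).mono
      (Finset.subset_univ (J (e i))))
    (fun i j _ r hr => habsent (e i) j r hr)
    (fun S hS S' hS' => hw b S S' hS.1 hS'.1 hS.2 hS'.2) (Nat.le_pow_clog one_lt_two _)
    (hp.trans (Equiv.sum_comp e _).symm) fun S hS => ?_
  by_cases hSb : ∀ r ∈ S, base r = b
  · exact hlow S hSb hS
  · push Not at hSb
    obtain ⟨r, hr, hrb⟩ := hSb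
    rw [hp, map_sum]
    refine Finset.sum_eq_zero fun i _ => ?_
    simp only [baseForm]
    rw [map_smul, shiftVars_map_prod_affineForm, setCoeff_prod_eq_zero_of_absent hr
      fun j _ => by rw [habsent _ j r hrb, map_zero], smul_zero]

variable {a : Fin k → MvPolynomial (Fin m) F} {p : MvPolynomial (Fin n) (MvPolynomial (Fin m) F)}

theorem setCoeff_union_eq_zero_of_forall_card_le (hδ : 1 ≤ δ)
    (hQ : Q.HasBaseSetsDistance base δ)
    (hw : SeparatesBaseSets base w (δ * Nat.clog 2 (k + 1)))
    (hp : p = ∑ i, a i • Q.polyGate base w i) {b : Fin m} {Z : Finset (Fin n)}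
    (hZ : ∀ r ∈ Z, base r ≠ b)
    (hlow : ∀ T : Finset (Fin n), (∀ r ∈ T, base r = b) → T.card ≤ Nat.clog 2 (k + 1) + δ →
      setCoeff (Z ∪ T) p = 0)
    {T : Finset (Fin n)} (hT : ∀ r ∈ T, base r = b) : setCoeff (Z ∪ T) p = 0 := by
  classical
  have hdisjoint : ∀ T : Finset (Fin n), (∀ r ∈ T, base r = b) → Disjoint Z T := fun T hT =>
    Finset.disjoint_left.2 fun r hr hrT => hZ r hr (hT r hrT)
  choose ε J _ _ hε using fun i => ((hQ.readOnce i).map MvPolynomial.C).exists_setCoeff_union_eq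
    (u := fun j => MvPolynomial.C (Q.lin i j).const + ∑ r,
      MvPolynomial.C ((Q.lin i j).coef r) * MvPolynomial.X (base r) ^ w r)
    Z (Finset.univ.filter fun r => base r = b)
  simp only [← shiftVars_map_prod_affineForm, ← gate_eq_prod_affineForm] at hε
  set p' : MvPolynomial (Fin n) (Polynomial (MvPolynomial (Fin m) F)) :=
    ∑ i, singleOut b (a i * ε i) • shiftVars (fun r => Polynomial.X ^ w r)
      (MvPolynomial.map Polynomial.C (∏ j ∈ J i, Q.baseForm base w b i j)) with hp'
  have hcoeff : ∀ T : Finset (Fin n), (∀ r ∈ T, base r = b) →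
      singleOut b (setCoeff (Z ∪ T) p) = setCoeff T p' := by
    intro T hT
    simp only [hp, hp', map_sum, map_smul, smul_eq_mul, map_mul, mul_assoc]
    refine Finset.sum_congr rfl fun i _ => ?_
    rw [← singleOut_setCoeff_shiftVars Q base w b i (J i) hT, polyGate,
      hε _ T (fun r hr => by simpa using hT r hr) (hdisjoint T hT), map_mul]
  have hzero : p' = 0 := sum_smul_shiftVars_prod_baseForm_eq_zero hδ hQ hw b hp' fun S hSb hS => by
    rw [← hcoeff S hSb, hlow S hSb hS, map_zero]
  exact singleOut_injective b (by rw [hcoeff T hT, hzero, map_zero, map_zero])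

theorem eq_zero_of_forall_base_card_le (hδ : 1 ≤ δ) (hQ : Q.HasBaseSetsDistance base δ)
    (hw : SeparatesBaseSets base w (δ * Nat.clog 2 (k + 1)))
    (hp : p = ∑ i, a i • Q.polyGate base w i)
    (hlow : ∀ S : Finset (Fin n),
      (∀ b, (S.filter fun r => base r = b).card ≤ Nat.clog 2 (k + 1) + δ) → setCoeff S p = 0) :
    p = 0 := by
  suffices hcoeff : ∀ (𝓢 : Finset (Fin m)) (S : Finset (Fin n)),
      (∀ b ∉ 𝓢, (S.filter fun r => base r = b).card ≤ Nat.clog 2 (k + 1) + δ) →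
      setCoeff S p = 0 by
    by_contra hne
    obtain ⟨S, hS⟩ := exists_setCoeff_ne_zero_of_mem_restrictDegree (hp ▸ sum_mem fun i _ =>
      Submodule.smul_mem _ _ (hQ.polyGate_mem_restrictDegree w i)) hne
    exact hS (hcoeff Finset.univ S (by simp))
  intro 𝓢
  induction 𝓢 using Finset.induction_on with
  | empty => exact fun S hS => hlow S fun b => hS b (Finset.notMem_empty b)
  | insert b 𝓢 _ ih =>
    intro S hS
    rw [← Finset.filter_union_filter_not_eq (fun r => base r = b) S, Finset.union_comm]
    refine setCoeff_union_eq_zero_of_forall_card_le hδ hQ hw hp (b := b)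
      (fun r hr => (Finset.mem_filter.1 hr).2) (fun T hT hcard => ih _ fun b' hb' => ?_)
      fun r hr => (Finset.mem_filter.1 hr).2
    by_cases hbb' : b' = b
    · refine (Finset.card_le_card ?_).trans hcard
      grind
    · refine (Finset.card_le_card ?_).trans (hS b' (by simp [hbb', hb']))
      grind

theorem eq_zero_of_forall_support_card_le (hδ : 1 ≤ δ) (hQ : Q.HasBaseSetsDistance base δ)
    (hw : SeparatesBaseSets base w (δ * Nat.clog 2 (k + 1)))
    (hp : p = ∑ i, a i • Q.polyGate base w i)
    (hlow : ∀ S : Finset (Fin n), S.card ≤ m * (Nat.clog 2 (k + 1) + δ) → setCoeff S p = 0) :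
    p = 0 := by
  refine eq_zero_of_forall_base_card_le hδ hQ hw hp fun S hS => hlow S ?_
  rw [Finset.card_eq_sum_card_fiberwise (f := base) (t := Finset.univ) (by simp [Set.MapsTo])]
  exact (Finset.sum_le_card_nsmul _ _ _ fun b _ => hS b).trans_eq (by simp)

end Depth3Circuit

open ReadOnceProduct in
/-- The dual form of concentration: a functional that vanishes on the coefficient vectors of small
support may be taken with coefficients in `A`. -/
theorem isConcentrated_map {A L : Type*} [CommRing A] [Field L] [Algebra A L] [IsFractionRing A L]
    {n k s : ℕ} {G : Fin k → MvPolynomial (Fin n) A}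
    (h : ∀ a : Fin k → A, (∀ S : Finset (Fin n), S.card < s →
      setCoeff S (∑ i, a i • G i) = 0) → ∑ i, a i • G i = 0) :
    IsConcentrated (fun i => MvPolynomial.map (algebraMap A L) (G i)) s := by
  suffices hspan : Submodule.span L {u | ∃ S : Finset (Fin n),
      coefVec (fun i => MvPolynomial.map (algebraMap A L) (G i)) S = u} ≤
      Submodule.span L {u | ∃ S : Finset (Fin n), S.card < s ∧
        coefVec (fun i => MvPolynomial.map (algebraMap A L) (G i)) S = u} by
    rw [IsConcentrated, Set.finrank, Set.finrank,
      hspan.antisymm (Submodule.span_mono fun u ⟨S, _, hS⟩ => ⟨S, hS⟩)]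
  rw [Submodule.span_le]
  rintro _ ⟨S, rfl⟩
  by_contra hS
  obtain ⟨f, hfS, hf⟩ := Submodule.exists_le_ker_of_notMem hS
  obtain ⟨d, hd⟩ := IsLocalization.exist_integer_multiples_of_finite (nonZeroDivisors A)
    fun i : Fin k => f (Pi.single i 1)
  choose a ha using hd
  have hfa : ∀ T, algebraMap A L (setCoeff T (∑ i, a i • G i)) =
      algebraMap A L d * f (coefVec (fun i => MvPolynomial.map (algebraMap A L) (G i)) T) := by
    intro T
    have hf1 (u : Fin k → L) : f u = ∑ i, u i * f (Pi.single i 1) := by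
      conv_lhs => rw [pi_eq_sum_univ' u, map_sum]
      exact Finset.sum_congr rfl fun i _ => map_smul f _ _
    have hcoef (i : Fin k) : coefVec (fun i => MvPolynomial.map (algebraMap A L) (G i)) T i =
        algebraMap A L (setCoeff T (G i)) := setCoeff_map _ T (G i)
    simp only [hf1 (coefVec _ T), hcoef, Finset.mul_sum, map_sum, map_smul, smul_eq_mul, map_mul]
    exact Finset.sum_congr rfl fun i _ => by
      rw [ha, Algebra.smul_def, mul_assoc, mul_comm (f _), mul_left_comm]
  have hzero := h a fun T hT => IsFractionRing.injective A L <| by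
    rw [hfa, LinearMap.mem_ker.1 (hf (Submodule.subset_span ⟨T, hT, rfl⟩)), mul_zero, map_zero]
  have hS := hfa S
  rw [hzero, map_zero, map_zero, eq_comm, mul_eq_zero] at hS
  have : Nontrivial A := (algebraMap A L).domain_nontrivial
  exact hS.elim (IsFractionRing.to_map_ne_zero_of_mem_nonZeroDivisors d.2) hfS

/-! ### Separating moduli and the hitting set -/

/-- A number whose product of differences is too small to be divisible by the least common multiple
of `1, …, 2 * N` leaves a modulus that divides none of them. -/
theorem exists_modEq_injOn {α : Type*} {C : Finset α} {a : α → ℕ} {v N : ℕ}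
    (ha : Set.InjOn a C) (hlt : ∀ x ∈ C, a x < 2 ^ v) (hN : v * C.card ^ 2 ≤ N) (hN3 : 3 ≤ N) :
    ∃ q, 2 ≤ q ∧ q ≤ 2 * N ∧ ∀ x ∈ C, ∀ y ∈ C, a x ≡ a y [MOD q] → x = y := by
  classical
  by_contra! hcon
  set P := ∏ z ∈ C.offDiag, ((a z.2 : ℤ) - a z.1).natAbs
  have hP0 : P ≠ 0 := Finset.prod_ne_zero_iff.2 fun z hz => by
    obtain ⟨hx, hy, hne⟩ := Finset.mem_offDiag.1 hz
    have := ha.ne hx hy hne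
    omega
  have hdvd : (2 * N).lcmUpto ∣ P := Finset.lcm_dvd fun q hq => by
    obtain rfl | hq2 := (Finset.mem_Icc.1 hq).1.eq_or_lt
    · exact one_dvd P
    obtain ⟨x, hx, y, hy, hmod, hne⟩ := hcon q hq2 (Finset.mem_Icc.1 hq).2
    exact (Int.natCast_dvd.1 (Nat.modEq_iff_dvd.1 hmod)).trans
      (Finset.dvd_prod_of_mem (fun z : α × α => ((a z.2 : ℤ) - a z.1).natAbs)
        (show (x, y) ∈ C.offDiag from Finset.mem_offDiag.2 ⟨hx, hy, hne⟩))
  have hle : P ≤ 2 ^ N :=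
    calc P ≤ (2 ^ v) ^ C.offDiag.card := Finset.prod_le_pow_card _ _ _ fun z hz => by
          obtain ⟨hx, hy, -⟩ := Finset.mem_offDiag.1 hz
          have := hlt _ hx
          have := hlt _ hy
          omega
      _ ≤ 2 ^ N := by
          rw [← pow_mul, Finset.offDiag_card, ← sq]
          exact Nat.pow_le_pow_right two_pos ((Nat.mul_le_mul_left v (Nat.sub_le _ _)).trans hN)
  have hlcm : 2 ^ N * 2 ^ N ≤ (2 * N + 1) * 2 ^ N :=
    calc 2 ^ N * 2 ^ N = 2 ^ (2 * N) := by rw [two_mul, pow_add]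
      _ ≤ (2 * N + 1) * (2 * N).lcmUpto := Chebyshev.two_pow_le_mul_lcmUpto _
      _ ≤ (2 * N + 1) * 2 ^ N :=
          Nat.mul_le_mul_left _ ((Nat.le_of_dvd (Nat.pos_of_ne_zero hP0) hdvd).trans hle)
  have hgrowth : ∀ M, 3 ≤ M → 2 * M + 1 < 2 ^ M := fun M hM => by
    induction M, hM using Nat.le_induction with
    | base => norm_num
    | succ M _ ih => rw [pow_succ]; omega
  exact (hgrowth N hN3).not_ge (Nat.le_of_mul_le_mul_right hlcm (by positivity))

namespace HittingSet

variable {n : ℕ}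

/-- The number of a set `S` of variables, with the digits `r + 1`, `r ∈ S`, to the base `n + 1`. -/
noncomputable def setNumber (S : Finset (Fin n)) : ℕ :=
  Nat.ofDigits (n + 1) (S.toList.map fun r : Fin n => (r + 1 : ℕ))

theorem setNumber_lt (hn : 1 ≤ n) (S : Finset (Fin n)) : setNumber S < (n + 1) ^ S.card := by
  simpa [setNumber] using Nat.ofDigits_lt_base_pow_length (b := n + 1) (by omega)
    (l := S.toList.map fun r : Fin n => (r + 1 : ℕ)) (by simp)

theorem count_digits_setNumber (hn : 1 ≤ n) (S : Finset (Fin n)) (r : Fin n) :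
    (Nat.digits (n + 1) (setNumber S)).count (r + 1 : ℕ) = if r ∈ S then 1 else 0 := by
  have hinj : Function.Injective fun r : Fin n => (r + 1 : ℕ) := fun r r' h => by
    simpa [Fin.ext_iff] using h
  rw [setNumber, Nat.digits_ofDigits _ (by omega) _ (by simp) fun h hlast => by
      simpa [hlast] using List.getLast_mem h,
    List.count_map_of_injective _ _ hinj r, S.nodup_toList.count]
  simp

theorem setNumber_injective (hn : 1 ≤ n) :
    Function.Injective (setNumber : Finset (Fin n) → ℕ) := fun S T h => by
  ext r
  have hr := count_digits_setNumber hn S r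
  rw [h, count_digits_setNumber hn T r] at hr
  split_ifs at hr <;> simp_all

theorem card_filter_card_le (hn : 1 ≤ n) (s : ℕ) :
    (Finset.univ.filter fun S : Finset (Fin n) => S.card ≤ s).card ≤ (n + 1) ^ s := by
  rw [← Finset.card_range ((n + 1) ^ s)]
  refine Finset.card_le_card_of_injOn setNumber (fun S hS => ?_) (setNumber_injective hn).injOn
  simpa using (setNumber_lt hn S).trans_le
    (Nat.pow_le_pow_right (by omega) (by simpa using hS))

theorem exists_injOn_sum_two_pow_mod (hn : 1 ≤ n) {s : ℕ} (hs : 1 ≤ s) :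
    ∃ q, 2 ≤ q ∧ q ≤ (n + 1) ^ (2 * s + 2) ∧
      Set.InjOn (fun S : Finset (Fin n) => ∑ r ∈ S, 2 ^ (r : ℕ) % q) {S | S.card ≤ s} := by
  have hmap (S : Finset (Fin n)) :
      ∑ r ∈ S, 2 ^ (r : ℕ) = ∑ i ∈ S.map Fin.valEmbedding, 2 ^ i := by simp
  have hinj : Function.Injective fun S : Finset (Fin n) => ∑ r ∈ S, 2 ^ (r : ℕ) := fun S T h => by
    simp only [hmap] at h
    exact Finset.map_injective _ (Finset.geomSum_injective le_rfl h)
  obtain ⟨q, hq2, hq, hsep⟩ := exists_modEq_injOn (v := n) (N := (n + 1) ^ (2 * s + 1))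
    (C := Finset.univ.filter fun S : Finset (Fin n) => S.card ≤ s) hinj.injOn
    (fun S _ => (hmap S).trans_lt (Nat.geomSum_lt le_rfl (by simp)))
    (by
      rw [pow_succ' (n + 1), mul_comm 2 s, pow_mul]
      exact Nat.mul_le_mul n.le_succ (Nat.pow_le_pow_left (card_filter_card_le hn s) 2))
    (calc 3 ≤ 2 ^ 3 := by norm_num
      _ ≤ (n + 1) ^ (2 * s + 1) :=
        (Nat.pow_le_pow_left (by omega) 3).trans (Nat.pow_le_pow_right (by omega) (by omega)))
  refine ⟨q, hq2, hq.trans ?_, fun S hS T hT h =>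
    hsep S (by simpa using hS) T (by simpa using hT) ?_⟩
  · rw [pow_succ' _ (2 * s + 1)]
    exact Nat.mul_le_mul_right _ (by omega)
  · rw [Nat.ModEq, Finset.sum_nat_mod, Finset.sum_nat_mod T]
    exact congrArg (· % q) h

section Point

variable {K : Type*} [Field K] {m : ℕ}

/-- The point with the given number `Z`. To the base `B`, the lowest digit of `Z` is `q - 2` for a
modulus `q`, the next `m` digits are the numbers of the values of the shift variables, and the rest
of `Z`, to the base `n + 1`, lists the variables `r` whose coordinate is raised by one, as digits
`r + 1`. -/
def point (elem : ℕ → K) (base : Fin n → Fin m) (B Z : ℕ) (r : Fin n) : K :=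
  elem (Z / B ^ (base r + 1 : ℕ) % B) ^ (2 ^ (r : ℕ) % (Z % B + 2)) +
    (Nat.digits (n + 1) (Z / B ^ (m + 1))).count (r + 1 : ℕ)

/-- The base of the digits in the numbers of the points. -/
def digitBase (n δ k : ℕ) : ℕ := (n + 1) ^ (5 * (δ * Nat.clog 2 (k + 1)))

/-- The hitting set: all points whose numbers have at most `2 * m + 1` digits, which leaves room for
`m` digits of `setNumber S`. -/
def points (elem : ℕ → K) (δ k : ℕ) (base : Fin n → Fin m) : List (Fin n → K) :=
  (List.range (digitBase n δ k ^ (2 * m + 1))).map (point elem base (digitBase n δ k))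

theorem exists_digits {B M : ℕ} (d : Fin M → Fin B) (X : ℕ) :
    ∃ Z, Z / B ^ M = X ∧ ∀ b : Fin M, Z / B ^ (b : ℕ) % B = d b := by
  have hlt := (finFunctionFinEquiv d).isLt
  refine ⟨finFunctionFinEquiv d + B ^ M * X, ?_, fun b => ?_⟩
  · rw [Nat.add_mul_div_left _ _ (by omega), Nat.div_eq_of_lt hlt, zero_add]
  · have hd := finFunctionFinEquiv_symm_apply_val (finFunctionFinEquiv d) b
    rw [Equiv.symm_apply_apply] at hd
    have hpos : 0 < B ^ (b : ℕ) := pow_pos (d b).pos _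
    have hpow : B ^ M * X = B ^ (b : ℕ) * (B * (B ^ (M - (b + 1)) * X)) := by
      rw [← pow_mul_pow_sub B (Nat.succ_le_of_lt b.isLt), pow_succ, mul_assoc, mul_assoc]
    rw [hd, hpow, Nat.add_mul_div_left _ _ hpos, Nat.add_mul_mod_self_left]

theorem exists_point_eq (hn : 1 ≤ n) (elem : ℕ → K) (base : Fin n → Fin m) {B q : ℕ} (hq : 2 ≤ q)
    (hqB : q < B + 2) (d : Fin m → Fin B) {S : Finset (Fin n)} (hS : (n + 1) ^ S.card ≤ B ^ m) :
    ∃ Z < B ^ (2 * m + 1), ∀ r, point elem base B Z r =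
      elem (d (base r)) ^ (2 ^ (r : ℕ) % q) + if r ∈ S then 1 else 0 := by
  obtain ⟨Z, hZ, hd⟩ := exists_digits (Fin.cons ⟨q - 2, by omega⟩ d : Fin (m + 1) → Fin B)
    (setNumber S)
  refine ⟨Z, ?_, fun r => ?_⟩
  · have hlt := (setNumber_lt hn S).trans_le hS
    rw [← hZ, Nat.div_lt_iff_lt_mul (pow_pos (d (base ⟨0, hn⟩)).pos _)] at hlt
    exact hlt.trans_eq (by ring)
  · have hq' := hd 0
    have hr := hd (base r).succ
    simp only [Fin.val_zero, pow_zero, Nat.div_one, Fin.cons_zero, Fin.val_succ, Fin.cons_succ]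
      at hq' hr
    rw [point, hZ, hq', hr, count_digits_setNumber hn, Nat.sub_add_cancel hq]
    split_ifs <;> simp

end Point

end HittingSet

namespace ReadOnceProduct

open MvPolynomial

section Evaluation

variable {A σ : Type*} [Finite σ] [DecidableEq σ]

theorem eval_indicator_eq_sum [CommSemiring A] {p : MvPolynomial σ A}
    (hp : p ∈ restrictDegree σ A 1) (S : Finset σ) :
    eval (fun r => if r ∈ S then 1 else 0) p = ∑ T ∈ S.powerset, setCoeff T p := by
  have := Fintype.ofFinite σ
  conv_lhs => rw [eq_sum_setCoeff_of_mem_restrictDegree hp]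
  simp only [map_sum, smul_eval, map_prod, eval_X, Finset.prod_ite_zero, Finset.prod_const_one,
    mul_ite, mul_one, mul_zero, ← Finset.sum_filter]
  refine Finset.sum_congr (Finset.ext fun T => ?_) fun _ _ => rfl
  simp [Finset.subset_iff]

theorem exists_eval_indicator_ne_zero [CommSemiring A] {p : MvPolynomial σ A}
    (hp : p ∈ restrictDegree σ A 1) {S₀ : Finset σ} (hS₀ : setCoeff S₀ p ≠ 0) :
    ∃ S ⊆ S₀, eval (fun r => if r ∈ S then 1 else 0) p ≠ 0 := by
  obtain ⟨S, hSS₀, hS⟩ := exists_minimal_le_of_wellFoundedLT (fun S => setCoeff S p ≠ 0) S₀ hS₀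
  refine ⟨S, hSS₀, ?_⟩
  rw [eval_indicator_eq_sum hp, Finset.sum_eq_single_of_mem S (Finset.mem_powerset_self S)]
  · exact hS.1
  · intro T hT hne
    by_contra hT0
    exact hne (hS.eq_of_ge hT0 (Finset.mem_powerset.1 hT)).symm

end Evaluation

theorem eval_shiftVars_map_C {F σ τ : Type*} [CommRing F] (b e : σ → MvPolynomial τ F)
    (p : MvPolynomial σ F) :
    eval e (shiftVars b (map C p)) = aeval (fun r => b r + e r) p := by
  have hhom : (eval e).comp ((shiftVars b).toRingHom.comp (map C)) =
      (aeval fun r => b r + e r : MvPolynomial σ F →ₐ[F] MvPolynomial τ F).toRingHom :=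
    ringHom_ext (fun a => by simp [algebraMap_eq]) fun r => by simp [shiftVars, add_comm]
  exact DFunLike.congr_fun hhom p

theorem degreeOf_aeval_le {F σ τ : Type*} [CommSemiring F] [Fintype σ] {q : MvPolynomial σ F}
    (hq : q ∈ restrictDegree σ F 1) {b : τ} {N : ℕ} {y : σ → MvPolynomial τ F}
    (hy : ∀ r, (y r).degreeOf b ≤ N) :
    (aeval y q).degreeOf b ≤ Fintype.card σ * N := by
  rw [eq_sum_setCoeff_of_mem_restrictDegree hq, map_sum]
  refine (degreeOf_sum_le _ _ _).trans (Finset.sup_le fun S _ => ?_)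
  rw [smul_eq_C_mul, map_mul, algHom_C, algebraMap_eq, map_prod]
  simp only [aeval_X]
  calc (C (setCoeff S q) * ∏ r ∈ S, y r).degreeOf b
    _ ≤ ∑ r ∈ S, (y r).degreeOf b := (degreeOf_C_mul_le _ _ _).trans (degreeOf_prod_le _ _ _)
    _ ≤ S.card * N := Finset.sum_le_card_nsmul _ _ N fun r _ => hy r
    _ ≤ Fintype.card σ * N := Nat.mul_le_mul_right _ (Finset.card_le_univ S)

theorem degreeOf_X_pow_add_ite_le {τ : Type*} [CommSemiring A] (a : τ) (e : ℕ) (b : τ) (P : Prop)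
    [Decidable P] : (X a ^ e + if P then 1 else 0 : MvPolynomial τ A).degreeOf b ≤ e := by
  classical
  cases subsingleton_or_nontrivial A
  · simp [Subsingleton.elim (X a ^ e + if P then 1 else 0 : MvPolynomial τ A) 0]
  refine (degreeOf_add_le _ _ _).trans (max_le ((degreeOf_pow_le _ _ _).trans ?_) ?_)
  · rw [degreeOf_X]
    split_ifs <;> simp
  · split_ifs <;> simp

theorem exists_aeval_comp_ne_zero {F K τ : Type*} [Field F] [Field K] [Algebra F K] [Finite τ]
    {B : ℕ} {elem : ℕ → K} (helem : Set.InjOn elem (Set.Iio B)) {f : MvPolynomial τ F} (hf : f ≠ 0)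
    (hdeg : ∀ b, f.degreeOf b < B) :
    ∃ d : τ → Fin B, aeval (fun b => elem (d b)) f ≠ 0 := by
  classical
  by_contra! hcon
  refine hf (map_injective _ (algebraMap F K).injective ?_)
  rw [map_zero]
  refine eq_zero_of_eval_zero_at_prod_finset _ (fun _ => (Finset.range B).image elem)
    (fun b => ?_) fun x hx => ?_
  · rw [Finset.card_image_of_injOn (by simpa [Set.InjOn] using helem), Finset.card_range]
    exact (degreeOf_le_iff.2 fun e he => degreeOf_le_iff.1 le_rfl e
      (support_map_subset _ _ he)).trans_lt (hdeg b)
  · simp only [Finset.mem_image, Finset.mem_range] at hx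
    choose d hd hdx using hx
    rw [eval_map, ← aeval_def]
    simpa [hdx] using hcon fun b => ⟨d b, hd b⟩

end ReadOnceProduct

namespace Depth3Circuit

open ReadOnceProduct

variable {F : Type*} [Field F] {n k m δ : ℕ} {Q : Depth3Circuit F n k} {base : Fin n → Fin m}

theorem HasBaseSetsDistance.poly_mem_restrictDegree (hQ : Q.HasBaseSetsDistance base δ) :
    Q.poly ∈ MvPolynomial.restrictDegree (Fin n) F 1 :=
  sum_mem fun i _ => by
    rw [← MvPolynomial.smul_eq_C_mul, gate_eq_prod_affineForm]
    exact Submodule.smul_mem _ _ (hQ.readOnce i).prod_mem_restrictDegree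

theorem shiftVars_map_poly (Q : Depth3Circuit F n k) (base : Fin n → Fin m) (w : Fin n → ℕ) :
    shiftVars (fun r => MvPolynomial.X (base r) ^ w r) (MvPolynomial.map MvPolynomial.C Q.poly) =
      ∑ i, (MvPolynomial.C (Q.weight i) : MvPolynomial (Fin m) F) • Q.polyGate base w i := by
  simp only [poly, polyGate, map_sum, map_mul, MvPolynomial.map_C, MvPolynomial.algHom_C,
    MvPolynomial.algebraMap_eq, MvPolynomial.smul_eq_C_mul]

theorem exists_aeval_shift_ne_zero {w : Fin n → ℕ} (hδ : 1 ≤ δ)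
    (hQ : Q.HasBaseSetsDistance base δ)
    (hw : SeparatesBaseSets base w (δ * Nat.clog 2 (k + 1))) (h0 : Q.poly ≠ 0) :
    ∃ S : Finset (Fin n), S.card ≤ m * (Nat.clog 2 (k + 1) + δ) ∧
      MvPolynomial.aeval (fun r => MvPolynomial.X (base r) ^ w r + if r ∈ S then 1 else 0 :
        Fin n → MvPolynomial (Fin m) F) Q.poly ≠ 0 := by
  set p := shiftVars (fun r => MvPolynomial.X (base r) ^ w r)
    (MvPolynomial.map MvPolynomial.C Q.poly) with hp
  have hpsum : p = _ := Q.shiftVars_map_poly base w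
  have hp0 : p ≠ 0 := fun h => by
    refine h0 (MvPolynomial.map_injective _ (MvPolynomial.C_injective (Fin m) F) ?_)
    rw [map_zero, ← shiftVars_neg_shiftVars (fun r => MvPolynomial.X (base r) ^ w r)
      (MvPolynomial.map MvPolynomial.C Q.poly), ← hp, h, map_zero]
  obtain ⟨S₀, hS₀, hne⟩ : ∃ S₀ : Finset (Fin n), S₀.card ≤ m * (Nat.clog 2 (k + 1) + δ) ∧
      setCoeff S₀ p ≠ 0 := by
    by_contra! h
    exact hp0 (eq_zero_of_forall_support_card_le hδ hQ hw hpsum h)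
  obtain ⟨S, hSS₀, hS⟩ := exists_eval_indicator_ne_zero (p := p) (hpsum ▸ sum_mem fun i _ =>
    Submodule.smul_mem _ _ (hQ.polyGate_mem_restrictDegree w i)) hne
  exact ⟨S, (Finset.card_le_card hSS₀).trans hS₀, by rwa [hp, eval_shiftVars_map_C] at hS⟩

theorem exists_mem_points_aeval_ne_zero {K : Type*} [Field K] [Algebra F K] {elem : ℕ → K}
    (hn : 1 ≤ n) (hδ : 1 ≤ δ) (hk : 1 ≤ k)
    (helem : Set.InjOn elem (Set.Iio (HittingSet.digitBase n δ k)))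
    (hQ : Q.HasBaseSetsDistance base δ) (h0 : Q.poly ≠ 0) :
    ∃ x ∈ HittingSet.points elem δ k base, MvPolynomial.aeval x Q.poly ≠ 0 := by
  set l := Nat.clog 2 (k + 1)
  have hl1 : 1 ≤ l := Nat.clog_pos one_lt_two (by omega)
  have hs1 : 1 ≤ δ * l := Nat.mul_pos hδ hl1
  obtain ⟨q, hq2, hq, hsep⟩ := HittingSet.exists_injOn_sum_two_pow_mod hn hs1
  obtain ⟨S, hS, hne⟩ := exists_aeval_shift_ne_zero (w := fun r => 2 ^ (r : ℕ) % q) hδ hQ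
    (fun _ S T _ _ hS hT => hsep hS hT) h0
  have hnq : n * q < HittingSet.digitBase n δ k :=
    calc n * q < (n + 1) * q := Nat.mul_lt_mul_of_pos_right n.lt_succ_self (by omega)
      _ ≤ (n + 1) * (n + 1) ^ (2 * (δ * l) + 2) := Nat.mul_le_mul_left _ hq
      _ = (n + 1) ^ (2 * (δ * l) + 3) := (pow_succ' _ _).symm
      _ ≤ (n + 1) ^ (5 * (δ * l)) := Nat.pow_le_pow_right (by omega) (by omega)
  obtain ⟨d, hd⟩ := exists_aeval_comp_ne_zero helem hne fun b =>
    (degreeOf_aeval_le hQ.poly_mem_restrictDegree fun r =>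
      (degreeOf_X_pow_add_ite_le _ _ b (r ∈ S)).trans (Nat.mod_lt _ (by omega)).le).trans_lt
      ((congrArg (· * q) (Fintype.card_fin n)).trans_lt hnq)
  have hlow : (n + 1) ^ S.card ≤ HittingSet.digitBase n δ k ^ m := by
    rw [HittingSet.digitBase, ← pow_mul]
    refine Nat.pow_le_pow_right (by omega) (hS.trans ?_)
    rw [mul_comm]
    exact Nat.mul_le_mul_right m (by nlinarith)
  obtain ⟨Z, hZ, hpoint⟩ := HittingSet.exists_point_eq hn elem base hq2 (by nlinarith) d hlow
  refine ⟨_, List.mem_map_of_mem (List.mem_range.2 hZ), ?_⟩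
  rw [MvPolynomial.comp_aeval_apply] at hd
  have hpt : HittingSet.point elem base (HittingSet.digitBase n δ k) Z = fun r =>
      MvPolynomial.aeval (fun b => elem (d b)) (MvPolynomial.X (base r) ^ (2 ^ (r : ℕ) % q) +
        if r ∈ S then 1 else 0 : MvPolynomial (Fin m) F) := by
    funext r
    rw [hpoint, map_add, map_pow, MvPolynomial.aeval_X, apply_ite (MvPolynomial.aeval _), map_one,
      map_zero]
  rwa [hpt]

end Depth3Circuit

namespace FieldRAM

/-! ### Running time and loops -/

section Run

variable {K : Type*} [Field K] {elem : ℕ → K} {s s' s'' : State K} {p q : Prog} {a b : NExp}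
  {t t' : ℕ}

/-- Started in `s`, the program `p` halts in the state `s'` after at most `t` steps. -/
def Run (elem : ℕ → K) (p : Prog) (t : ℕ) (s s' : State K) : Prop :=
  ∃ u ≤ t, Exec elem p s u s'

theorem Run.mono (h : Run elem p t s s') (htt' : t ≤ t') : Run elem p t' s s' :=
  let ⟨u, hu, he⟩ := h
  ⟨u, hu.trans htt', he⟩

theorem Run.skip (s : State K) : Run elem .skip 1 s s :=
  ⟨1, le_rfl, .skip s⟩

theorem Run.seq (hp : Run elem p t s s') (hq : Run elem q t' s' s'') :
    Run elem (.seq p q) (t + t' + 1) s s'' :=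
  let ⟨_, _, he⟩ := hp
  let ⟨_, _, he'⟩ := hq
  ⟨_, by omega, .seq he he'⟩

theorem Run.ite_true (h : a.eval s.mem < b.eval s.mem) (hp : Run elem p t s s') :
    Run elem (.ite a b p q) (a.cost + b.cost + t + 1) s s' :=
  let ⟨_, _, he⟩ := hp
  ⟨_, by omega, .ite_true h he⟩

theorem Run.ite_false (h : ¬ a.eval s.mem < b.eval s.mem) (hq : Run elem q t s s') :
    Run elem (.ite a b p q) (a.cost + b.cost + t + 1) s s' :=
  let ⟨_, _, he⟩ := hq
  ⟨_, by omega, .ite_false h he⟩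

theorem Run.while_true (h : a.eval s.mem < b.eval s.mem) (hp : Run elem p t s s')
    (hw : Run elem (.while a b p) t' s' s'') :
    Run elem (.while a b p) (a.cost + b.cost + t + t' + 1) s s'' :=
  let ⟨_, _, he⟩ := hp
  let ⟨_, _, he'⟩ := hw
  ⟨_, by omega, .while_true h he he'⟩

theorem Run.while_false (h : ¬ a.eval s.mem < b.eval s.mem) :
    Run elem (.while a b p) (a.cost + b.cost + 1) s s :=
  ⟨_, le_rfl, .while_false h⟩

theorem Run.while_of_forall_lt {c : ℕ} (σ : ℕ → State K) (N : ℕ)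
    (htest : ∀ i < N, a.eval (σ i).mem < b.eval (σ i).mem)
    (hend : ¬ a.eval (σ N).mem < b.eval (σ N).mem)
    (hbody : ∀ i < N, Run elem p c (σ i) (σ (i + 1))) :
    Run elem (.while a b p) (N * (a.cost + b.cost + c + 1) + (a.cost + b.cost + 1))
      (σ 0) (σ N) := by
  induction N generalizing σ with
  | zero => exact (Run.while_false hend).mono (by omega)
  | succ N ih =>
    have hrest := ih (fun i => σ (i + 1)) (fun i hi => htest _ (by omega)) hend
      (fun i hi => hbody _ (by omega))
    refine (Run.while_true (htest 0 (by omega)) (hbody 0 (by omega)) hrest).mono ?_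
    rw [add_mul, one_mul]
    omega

end Run

/-! ### Registers -/

/-- The registers of the program, kept in consecutive cells above the input: the base `B` of the
digits, the number `T` of points, the number `Z` of the current point, the variable `r`, a number
`V` that is being taken apart, a quotient `y`, loop counters `i` and `j`, the number `v` of a field
element, an exponent `e`, a modulus `q` and a power `P` of two. -/
inductive Reg
  | B | T | Z | r | V | y | i | j | v | e | q | P

/-- The contents of the registers. -/
structure Regs where
  B : ℕ := 0
  T : ℕ := 0
  Z : ℕ := 0
  r : ℕ := 0
  V : ℕ := 0
  y : ℕ := 0
  i : ℕ := 0
  j : ℕ := 0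
  v : ℕ := 0
  e : ℕ := 0
  q : ℕ := 0
  P : ℕ := 0

namespace Regs

/-- The content of a register. -/
def get (ρ : Regs) : Reg → ℕ
  | .B => ρ.B
  | .T => ρ.T
  | .Z => ρ.Z
  | .r => ρ.r
  | .V => ρ.V
  | .y => ρ.y
  | .i => ρ.i
  | .j => ρ.j
  | .v => ρ.v
  | .e => ρ.e
  | .q => ρ.q
  | .P => ρ.P

/-- The contents after `x` is written to the register `a`. -/
def set (ρ : Regs) (a : Reg) (x : ℕ) : Regs :=
  match a with
  | .B => { ρ with B := x }
  | .T => { ρ with T := x }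
  | .Z => { ρ with Z := x }
  | .r => { ρ with r := x }
  | .V => { ρ with V := x }
  | .y => { ρ with y := x }
  | .i => { ρ with i := x }
  | .j => { ρ with j := x }
  | .v => { ρ with v := x }
  | .e => { ρ with e := x }
  | .q => { ρ with q := x }
  | .P => { ρ with P := x }

@[simp] theorem get_set (ρ : Regs) (a : Reg) (x : ℕ) : (ρ.set a x).get a = x := by
  cases a <;> rfl

theorem set_set (ρ : Regs) (a : Reg) (x x' : ℕ) : (ρ.set a x).set a x' = ρ.set a x' := by
  cases a <;> rfl

/-- The content of the register with the given position; `0` beyond the last register. -/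
def cell (ρ : Regs) (p : ℕ) : ℕ :=
  (([.B, .T, .Z, .r, .V, .y, .i, .j, .v, .e, .q, .P] : List Reg)[p]?).elim 0 ρ.get

theorem cell_ctorIdx (ρ : Regs) (a : Reg) : ρ.cell a.ctorIdx = ρ.get a := by
  cases a <;> rfl

theorem cell_set (ρ : Regs) (a : Reg) (x : ℕ) :
    (ρ.set a x).cell = Function.update ρ.cell a.ctorIdx x := by
  funext p
  rw [Function.update_apply]
  by_cases hp : p < 12
  · cases a <;> interval_cases p <;> rfl
  · obtain ⟨c, rfl⟩ := Nat.exists_eq_add_of_le' (not_lt.1 hp)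
    cases a <;> exact (if_neg (by simp [Reg.ctorIdx])).symm

end Regs

section Store

variable {K : Type*} [Field K] {elem : ℕ → K} {inp : ℕ → ℕ} {ρ : Regs} {f : K} {out : List K}

/-- The state with the input `inp` in the cells below `inp 0 + 4`, the registers above them, and one
field element. -/
def store (inp : ℕ → ℕ) (ρ : Regs) (f : K) (out : List K) : State K where
  mem a := if a < inp 0 + 4 then inp a else ρ.cell (a - (inp 0 + 4))
  fmem a := if a = 0 then f else 0
  out := out

/-- The expression for the address of a register: the registers follow the `inp 0 + 4` cells of the
input, and cell `0` holds `inp 0`. -/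
def adr (a : Reg) : NExp := .add (.read (.const 0)) (.const (4 + a.ctorIdx))

/-- The expression for the content of a register. -/
def reg (a : Reg) : NExp := .read (adr a)

/-- The expression for the content of an input cell. -/
def input (a : ℕ) : NExp := .read (.const a)

theorem eval_adr (a : Reg) :
    (adr a).eval (store inp ρ f out).mem = inp 0 + 4 + a.ctorIdx := by
  simp [adr, NExp.eval, store, add_assoc]

@[simp] theorem eval_reg (a : Reg) :
    (reg a).eval (store inp ρ f out).mem = ρ.get a := by
  rw [reg, NExp.eval, eval_adr]
  simp [store, Regs.cell_ctorIdx]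

theorem mem_store_of_lt {a : ℕ} (ha : a < inp 0 + 4) : (store inp ρ f out).mem a = inp a :=
  if_pos ha

@[simp] theorem cost_adr (a : Reg) : (adr a).cost = 4 := rfl

@[simp] theorem cost_reg (a : Reg) : (reg a).cost = 5 := rfl

@[simp] theorem cost_input (a : ℕ) : (input a).cost = 2 := rfl

/-- The assignment of the value of `e` to the register `a`. -/
def assign (a : Reg) (e : NExp) : Prog := .setN (adr a) e

theorem run_assign {a : Reg} {e : NExp} {x : ℕ} (he : e.eval (store inp ρ f out).mem = x) :
    Run elem (assign a e) (e.cost + 5) (store inp ρ f out) (store inp (ρ.set a x) f out) := by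
  refine ⟨(adr a).cost + e.cost + 1, by simp only [cost_adr]; omega, ?_⟩
  rw [assign]
  convert Exec.setN (elem := elem) (adr a) e (store inp ρ f out) using 1
  rw [eval_adr, he]
  simp only [store, State.mk.injEq, and_true]
  funext b
  simp only [Function.update_apply, Regs.cell_set]
  split_ifs <;> first | rfl | omega

theorem run_copy (a b : Reg) :
    Run elem (assign a (reg b)) 10 (store inp ρ f out) (store inp (ρ.set a (ρ.get b)) f out) :=
  run_assign (eval_reg b)

theorem run_setF {x : FExp} {g : K} (hx : x.eval elem (store inp ρ f out) = g) :
    Run elem (.setF (.const 0) x) (x.cost + 2) (store inp ρ f out) (store inp ρ g out) := by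
  refine ⟨(NExp.const 0).cost + x.cost + 1, by simp only [NExp.cost]; omega, ?_⟩
  convert Exec.setF (elem := elem) (.const 0) x (store inp ρ f out) using 1
  rw [hx]
  simp only [store, State.mk.injEq, and_true, true_and, NExp.eval]
  funext b
  rw [Function.update_apply]
  split_ifs <;> rfl

theorem run_emit {x : FExp} {g : K} (hx : x.eval elem (store inp ρ f out) = g) :
    Run elem (.emit x) (x.cost + 1) (store inp ρ f out) (store inp ρ f (out ++ [g])) :=
  ⟨_, le_rfl, hx ▸ Exec.emit x (store inp ρ f out)⟩

/-- The registers of a list are set to `0`. -/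
def clear : List Reg → Prog
  | [] => .skip
  | a :: as => .seq (assign a (.const 0)) (clear as)

theorem run_clear (as : List Reg) :
    Run elem (clear as) (7 * as.length + 1) (store inp ρ f out)
      (store inp (as.foldl (fun ρ a => ρ.set a 0) ρ) f out) := by
  induction as generalizing ρ with
  | nil => exact Run.skip _
  | cons a as ih =>
    refine (Run.seq (run_assign rfl) ih).mono ?_
    simp only [NExp.cost, List.length_cons]
    omega

/-- The body `p` for every value of the counter `a` from `0` to below `lim`; the counter is
cleared afterwards. -/
def forLoop (a : Reg) (lim : NExp) (p : Prog) : Prog :=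
  .seq (clear [a]) (.seq (.while (reg a) lim (.seq p (assign a (.add (reg a) (.const 1)))))
    (clear [a]))

theorem run_forLoop {a : Reg} {lim : NExp} {p : Prog} {N W c : ℕ} (ρ : ℕ → Regs) (f : ℕ → K)
    (out : ℕ → List K) (hcost : lim.cost ≤ 20) (hN : N ≤ W) (hW : 1 ≤ W)
    (hlim : ∀ t, lim.eval (store inp ((ρ t).set a t) (f t) (out t)).mem = N)
    (hbody : ∀ t < N, Run elem p c (store inp ((ρ t).set a t) (f t) (out t))
      (store inp ((ρ (t + 1)).set a t) (f (t + 1)) (out (t + 1)))) :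
    Run elem (forLoop a lim p) (W * (c + 100)) (store inp (ρ 0) (f 0) (out 0))
      (store inp ((ρ N).set a 0) (f N) (out N)) := by
  have hcounter : ∀ t, (reg a).eval (store inp ((ρ t).set a t) (f t) (out t)).mem = t := by
    intro t
    rw [eval_reg, Regs.get_set]
  have hincr : ∀ t, Run elem (assign a (.add (reg a) (.const 1))) 12
      (store inp ((ρ (t + 1)).set a t) (f (t + 1)) (out (t + 1)))
      (store inp ((ρ (t + 1)).set a (t + 1)) (f (t + 1)) (out (t + 1))) := by
    intro t
    rw [← Regs.set_set _ a t (t + 1)]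
    exact run_assign (by simp [NExp.eval])
  have hwhile := Run.while_of_forall_lt (a := reg a) (b := lim)
    (fun t => store inp ((ρ t).set a t) (f t) (out t)) N
    (fun t ht => by rwa [hcounter, hlim]) (by rw [hcounter, hlim]; exact lt_irrefl N)
    (fun t ht => (hbody t ht).seq (hincr t))
  have hstart := run_clear (elem := elem) (inp := inp) (ρ := ρ 0) (f := f 0) (out := out 0) [a]
  have hend := run_clear (elem := elem) (inp := inp) (ρ := (ρ N).set a N) (f := f N)
    (out := out N) [a]
  simp only [List.foldl_cons, List.foldl_nil, Regs.set_set] at hstart hend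
  refine (hstart.seq (hwhile.seq hend)).mono ?_
  simp only [cost_reg, List.length_singleton]
  have : N * (5 + lim.cost + (c + 12 + 1) + 1) ≤ W * (c + 39) := Nat.mul_le_mul hN (by omega)
  nlinarith

end Store

/-! ### Printing one coordinate -/

section Digits

variable {K : Type*} [Field K] {elem : ℕ → K} {inp : ℕ → ℕ} {ρ : Regs} {f : K} {out : List K}

/-- Division of the register `V` by the value of `D`: the remainder stays in `V`, the quotient
goes to `y`. -/
def divBy (D : NExp) : Prog :=
  .seq (clear [.y]) (.while D (.add (reg .V) (.const 1))
    (.seq (assign .V (.sub (reg .V) D)) (assign .y (.add (reg .y) (.const 1)))))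

theorem run_divBy {D : NExp} {d : ℕ} (hd : 0 < d) (hcost : D.cost ≤ 5)
    (hD : ∀ V y, D.eval (store inp { ρ with V := V, y := y } f out).mem = d) :
    Run elem (divBy D) (50 * ρ.V + 50) (store inp ρ f out)
      (store inp { ρ with V := ρ.V % d, y := ρ.V / d } f out) := by
  have hle : ∀ i < ρ.V / d, d * (i + 1) ≤ ρ.V := fun i hi =>
    (Nat.mul_le_mul_left d hi).trans (Nat.mul_div_le ρ.V d)
  have hlast : ρ.V - d * (ρ.V / d) = ρ.V % d := (Nat.mod_eq_sub_mul_div ..).symm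
  have hwhile := Run.while_of_forall_lt (elem := elem) (a := D) (b := .add (reg .V) (.const 1))
    (p := .seq (assign .V (.sub (reg .V) D)) (assign .y (.add (reg .y) (.const 1)))) (c := 30)
    (fun i => store inp { ρ with V := ρ.V - d * i, y := i } f out) (ρ.V / d)
    (fun i hi => by
      have := hle i hi
      simp only [NExp.eval, eval_reg, hD, Regs.get, mul_add, mul_one] at this ⊢
      omega)
    (by
      simp only [NExp.eval, eval_reg, hD, Regs.get, hlast]
      exact not_lt.2 (Nat.mod_lt ρ.V hd))
    (fun i _ => ((run_assign (x := ρ.V - d * (i + 1)) (by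
        simp only [NExp.eval, eval_reg, hD, Regs.get, mul_add, mul_one, Nat.sub_sub])).seq
      (run_assign (x := i + 1) (by simp only [NExp.eval, eval_reg, Regs.get, Regs.set]))).mono (by
        simp only [NExp.cost, cost_reg]
        omega))
  rw [hlast] at hwhile
  refine ((run_clear [.y]).seq hwhile).mono ?_
  simp only [NExp.cost, cost_reg, List.length_singleton]
  have := Nat.mul_le_mul (Nat.div_le_self ρ.V d) (by omega : D.cost + (5 + 1 + 1) + 30 + 1 ≤ 50)
  omega

/-- The quotient left in `y` by `divBy`, or the product left there by `mulBy`, moves to `V`. -/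
def takeOver : Prog := .seq (assign .V (reg .y)) (clear [.y])

theorem run_takeOver :
    Run elem takeOver 20 (store inp ρ f out) (store inp { ρ with V := ρ.y, y := 0 } f out) :=
  ((run_copy .V .y).seq (run_clear [.y])).mono (by simp)

/-- The quotient of `Z` by the power of `B` whose exponent is the value of `lim`, in the
register `V`. -/
def higherDigits (lim : NExp) : Prog :=
  .seq (assign .V (reg .Z)) (.seq (clear [.y])
    (forLoop .i lim (.seq (divBy (reg .B)) takeOver)))

theorem run_higherDigits {lim : NExp} {L W : ℕ} (hcost : lim.cost ≤ 20)
    (hlim : ∀ V y i, lim.eval (store inp { ρ with V := V, y := y, i := i } f out).mem = L)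
    (hB : 0 < ρ.B) (hZ : ρ.Z ≤ W) (hL : L ≤ W) (hW : 1 ≤ W) :
    Run elem (higherDigits lim) (260 * W ^ 2) (store inp ρ f out)
      (store inp { ρ with V := ρ.Z / ρ.B ^ L, y := 0, i := 0 } f out) := by
  have hloop := run_forLoop (elem := elem) (a := .i) (lim := lim)
    (p := .seq (divBy (reg .B)) takeOver) (c := 50 * W + 80)
    (fun t => { ρ with V := ρ.Z / ρ.B ^ t, y := 0 }) (fun _ => f) (fun _ => out) hcost hL hW
    (fun t => hlim _ _ _)
    (fun t _ => by
      simp only [pow_succ, ← Nat.div_div_eq_div_mul]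
      refine ((run_divBy hB (by simp) (fun V y => by simp only [eval_reg]; rfl)).seq
        run_takeOver).mono ?_
      have : ρ.Z / ρ.B ^ t ≤ W := (Nat.div_le_self _ _).trans hZ
      simp only [Regs.set]
      omega)
  simp only [pow_zero, Nat.div_one] at hloop
  refine ((run_copy .V .Z).seq
    ((run_clear [.y]).seq hloop)).mono ?_
  simp only [List.length_singleton]
  nlinarith

/-- The digit of `Z` to the base `B` whose position is the value of `lim`, in the register `V`. -/
def digit (lim : NExp) : Prog :=
  .seq (higherDigits lim) (.seq (divBy (reg .B)) (clear [.y]))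

theorem run_digit {lim : NExp} {L W : ℕ} (hcost : lim.cost ≤ 20)
    (hlim : ∀ V y i, lim.eval (store inp { ρ with V := V, y := y, i := i } f out).mem = L)
    (hB : 0 < ρ.B) (hZ : ρ.Z ≤ W) (hL : L ≤ W) (hW : 1 ≤ W) :
    Run elem (digit lim) (400 * W ^ 2) (store inp ρ f out)
      (store inp { ρ with V := ρ.Z / ρ.B ^ L % ρ.B, y := 0, i := 0 } f out) := by
  refine ((run_higherDigits hcost hlim hB hZ hL hW).seq ((run_divBy hB (by simp)
    (fun V y => by simp only [eval_reg]; rfl)).seq (run_clear [.y]))).mono ?_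
  have : ρ.Z / ρ.B ^ L ≤ W := (Nat.div_le_self _ _).trans hZ
  simp only [List.length_singleton]
  nlinarith

/-- `1` is added to the field cell if `V` is the digit `r + 1`, which stands for the coordinate `r`;
a digit `0` stands for no coordinate. -/
def countIfEq : Prog :=
  .ite (reg .V) (.add (reg .r) (.const 1)) .skip
    (.ite (.add (reg .r) (.const 1)) (reg .V) .skip
      (.setF (.const 0) (.add (.read (.const 0)) .one)))

theorem run_countIfEq :
    Run elem countIfEq 40 (store inp ρ f out)
      (store inp ρ (f + if ρ.V = ρ.r + 1 then 1 else 0) out) := by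
  have hr : (NExp.add (reg .r) (.const 1)).eval (store inp ρ f out).mem = ρ.r + 1 := by
    simp only [NExp.eval, eval_reg, Regs.get]
  have hV : (reg .V).eval (store inp ρ f out).mem = ρ.V := by
    simp only [eval_reg, Regs.get]
  rcases lt_trichotomy ρ.V (ρ.r + 1) with h | h | h
  · rw [if_neg h.ne, add_zero]
    exact (Run.ite_true (by rwa [hr, hV]) (Run.skip _)).mono (by simp [NExp.cost])
  · rw [if_pos h]
    exact (Run.ite_false (by rw [hr, hV]; exact h.not_lt) (Run.ite_false
      (by rw [hr, hV]; exact h.not_gt) (run_setF rfl))).mono (by simp [NExp.cost, FExp.cost])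
  · rw [if_neg h.ne', add_zero]
    exact (Run.ite_false (by rw [hr, hV]; exact h.le.not_gt)
      (Run.ite_true (by rwa [hr, hV]) (Run.skip _))).mono (by simp [NExp.cost])

/-- The number of digits `r + 1` of `V` to the base `n + 1` is added to the field cell. -/
def countDigits : Prog :=
  .while (.const 0) (reg .V)
    (.seq (divBy (.add (input 0) (.const 1))) (.seq countIfEq takeOver))

theorem run_countDigits (hn : 0 < inp 0) (V : ℕ) :
    Run elem countDigits (300 * V + 7) (store inp { ρ with V := V, y := 0 } f out)
      (store inp { ρ with V := 0, y := 0 }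
        (f + (Nat.digits (inp 0 + 1) V).count (ρ.r + 1)) out) := by
  induction V using Nat.strong_induction_on generalizing f with
  | _ V ih =>
    rcases Nat.eq_zero_or_pos V with rfl | hV
    · simp only [Nat.digits_zero, List.count_nil, Nat.cast_zero, add_zero]
      exact Run.while_false (by simp [NExp.eval, Regs.get])
    · have hdigits : f + ((Nat.digits (inp 0 + 1) V).count (ρ.r + 1) : K) =
          f + (if V % (inp 0 + 1) = ρ.r + 1 then 1 else 0) +
            (Nat.digits (inp 0 + 1) (V / (inp 0 + 1))).count (ρ.r + 1) := by
        rw [Nat.digits_def' (by omega) hV, List.count_cons]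
        split_ifs <;> simp_all [add_assoc, add_comm]
      rw [hdigits]
      have hdiv := run_divBy (elem := elem) (inp := inp) (ρ := { ρ with V := V, y := 0 })
        (f := f) (out := out) (D := .add (input 0) (.const 1)) (d := inp 0 + 1) (by omega)
        (by simp [NExp.cost]) (fun V y => by simp [input, NExp.eval, store])
      refine (Run.while_true (by simpa [NExp.eval, Regs.get] using hV)
        (hdiv.seq (run_countIfEq.seq run_takeOver))
        (ih _ (Nat.div_lt_self hV (by omega)))).mono ?_
      have : V / (inp 0 + 1) ≤ V / 2 := Nat.div_le_div_left (by omega) two_pos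
      simp only [NExp.cost, cost_reg]
      omega

end Digits

section Coordinate

variable {K : Type*} [Field K] {elem : ℕ → K} {inp : ℕ → ℕ} {ρ : Regs} {f : K} {out : List K}

/-- The residue of `2 ^ r` modulo `q`, in the register `e`. -/
def powTwoMod : Prog :=
  .seq (assign .e (.const 1)) (forLoop .i (reg .r)
    (.seq (assign .e (.add (reg .e) (reg .e)))
      (.ite (reg .e) (reg .q) .skip (assign .e (.sub (reg .e) (reg .q))))))

theorem two_mul_mod_eq_ite {x q : ℕ} (hx : x < q) :
    2 * x % q = if x + x < q then x + x else x + x - q := by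
  rw [two_mul]
  split_ifs with h
  · exact Nat.mod_eq_of_lt h
  · rw [Nat.mod_eq_sub_mod (not_lt.1 h), Nat.mod_eq_of_lt (by omega)]

theorem run_powTwoMod {W : ℕ} (hq : 2 ≤ ρ.q) (hr : ρ.r ≤ W) (hW : 1 ≤ W) :
    Run elem powTwoMod (200 * W) (store inp ρ f out)
      (store inp { ρ with e := 2 ^ ρ.r % ρ.q, i := 0 } f out) := by
  have hloop := run_forLoop (elem := elem) (inp := inp) (a := .i) (lim := reg .r)
    (p := .seq (assign .e (.add (reg .e) (reg .e)))
      (.ite (reg .e) (reg .q) .skip (assign .e (.sub (reg .e) (reg .q))))) (c := 50)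
    (fun t => { ρ with e := 2 ^ t % ρ.q }) (fun _ => f) (fun _ => out) (by simp) hr hW
    (fun t => by simp only [eval_reg, Regs.get, Regs.set])
    (fun t _ => by
      have hlt : 2 ^ t % ρ.q < ρ.q := Nat.mod_lt _ (by omega)
      have hstep : 2 ^ (t + 1) % ρ.q = 2 * (2 ^ t % ρ.q) % ρ.q := by
        rw [pow_succ', Nat.mul_mod_mod]
      rw [hstep, two_mul_mod_eq_ite hlt]
      refine Run.mono (t := 18 + (5 + 5 + 18 + 1) + 1) ?_ (by omega)
      refine Run.seq ((run_assign (x := 2 ^ t % ρ.q + 2 ^ t % ρ.q) (by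
        simp only [NExp.eval, eval_reg, Regs.get, Regs.set])).mono (by simp [NExp.cost])) ?_
      split_ifs with h
      · exact (Run.ite_true (by simpa only [eval_reg, Regs.get, Regs.set] using h)
          (Run.skip _)).mono (by simp)
      · exact (Run.ite_false (by simpa only [eval_reg, Regs.get, Regs.set] using h)
          (run_assign (by simp only [NExp.eval, eval_reg, Regs.get, Regs.set]))).mono
            (by simp [NExp.cost]))
  simp only [pow_zero, Nat.mod_eq_of_lt (show 1 < ρ.q by omega)] at hloop
  refine ((run_assign rfl).seq hloop).mono ?_
  simp only [NExp.cost]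
  omega

/-- The power of the field element number `v` with exponent `e`, in the field cell. -/
def powElem : Prog :=
  .seq (.setF (.const 0) .one)
    (forLoop .i (reg .e) (.setF (.const 0) (.mul (.read (.const 0)) (.elem (reg .v)))))

theorem run_powElem {W : ℕ} (he : ρ.e ≤ W) (hW : 1 ≤ W) :
    Run elem powElem (120 * W) (store inp ρ f out)
      (store inp { ρ with i := 0 } (elem ρ.v ^ ρ.e) out) := by
  have hloop := run_forLoop (elem := elem) (inp := inp) (a := .i) (lim := reg .e)
    (p := .setF (.const 0) (.mul (.read (.const 0)) (.elem (reg .v)))) (c := 15)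
    (fun _ => ρ) (fun t => elem ρ.v ^ t) (fun _ => out) (by simp) he hW
    (fun t => by simp only [eval_reg, Regs.get, Regs.set])
    (fun t _ => (run_setF (by
      simp only [FExp.eval, eval_reg, Regs.get, Regs.set, pow_succ]
      rfl)).mono (by simp [FExp.cost, NExp.cost]))
  simp only [pow_zero] at hloop
  refine ((run_setF rfl).seq hloop).mono ?_
  simp only [FExp.cost]
  omega

/-- The coordinate `r` of the point number `Z`, as a function of the input and of the base `B` of
the digits. -/
def coordinate (elem : ℕ → K) (inp : ℕ → ℕ) (B Z r : ℕ) : K :=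
  elem (Z / B ^ (inp (4 + r) + 1) % B) ^ (2 ^ r % (Z % B + 2)) +
    (Nat.digits (inp 0 + 1) (Z / B ^ (inp 1 + 1))).count (r + 1)

/-- The registers `q` and `v`: the modulus and the number of the field element that belong to the
coordinate `r` of the point number `Z`. -/
def loadDigits : Prog :=
  .seq (digit (.const 0)) (.seq (assign .q (.add (reg .V) (.const 2)))
    (.seq (digit (.add (.read (.add (.const 4) (reg .r))) (.const 1)))
      (assign .v (reg .V))))

theorem run_loadDigits {W : ℕ} (hB : 0 < ρ.B) (hr : ρ.r < inp 0) (hZ : ρ.Z ≤ W)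
    (hbase : inp (4 + ρ.r) + 1 ≤ W) :
    Run elem loadDigits (900 * W ^ 2) (store inp ρ f out)
      (store inp { ρ with
        V := ρ.Z / ρ.B ^ (inp (4 + ρ.r) + 1) % ρ.B, y := 0, i := 0, q := ρ.Z % ρ.B + 2,
        v := ρ.Z / ρ.B ^ (inp (4 + ρ.r) + 1) % ρ.B } f out) := by
  have hmodulus := run_digit (elem := elem) (inp := inp) (ρ := ρ) (f := f) (out := out)
    (lim := .const 0) (L := 0) (by simp [NExp.cost]) (fun _ _ _ => rfl) hB hZ (by omega)
    (by omega : 1 ≤ W)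
  rw [pow_zero, Nat.div_one] at hmodulus
  have hvalue := run_digit (elem := elem) (inp := inp) (f := f) (out := out) (W := W)
    (ρ := { ρ with V := ρ.Z % ρ.B, y := 0, i := 0, q := ρ.Z % ρ.B + 2 })
    (lim := .add (.read (.add (.const 4) (reg .r))) (.const 1)) (L := inp (4 + ρ.r) + 1)
    (by simp [NExp.cost])
    (fun V y i => by
      simp only [NExp.eval, eval_reg, Regs.get]
      rw [mem_store_of_lt (by omega)])
    hB hZ hbase (by omega)
  refine (hmodulus.seq ((run_assign (by simp only [NExp.eval, eval_reg]; rfl)).seq (hvalue.seq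
    (run_copy .v .V)))).mono ?_
  simp only [NExp.cost, cost_reg]
  nlinarith

/-- The coordinate `r` of the point number `Z` is printed; the scratch registers and the field cell
are `0` before and after. -/
def printCoordinate : Prog :=
  .seq loadDigits (.seq powTwoMod (.seq powElem
    (.seq (higherDigits (.add (input 1) (.const 1))) (.seq countDigits
      (.seq (.emit (.read (.const 0))) (.seq (clear [.e, .q, .v]) (.setF (.const 0) .zero)))))))

theorem run_printCoordinate {B T Z r W : ℕ} (hB : 0 < B) (hr : r < inp 0) (hrW : r ≤ W)
    (hZ : Z < W) (hbase : inp (4 + r) + 1 ≤ W) (hm : inp 1 + 1 ≤ W) :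
    Run elem printCoordinate (2000 * W ^ 2)
      (store inp { B := B, T := T, Z := Z, r := r } 0 out)
      (store inp { B := B, T := T, Z := Z, r := r } 0 (out ++ [coordinate elem inp B Z r])) := by
  have hW : 1 ≤ W := by omega
  have he : 2 ^ r % (Z % B + 2) ≤ W := by
    have := Nat.mod_lt (2 ^ r) (by omega : 0 < Z % B + 2)
    have := Nat.mod_le Z B
    omega
  refine ((run_loadDigits hB hr hZ.le hbase).seq ((run_powTwoMod (W := W) (by simp) hrW hW).seq
    ((run_powElem he hW).seq ((run_higherDigits (W := W) (L := inp 1 + 1) (by simp [NExp.cost])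
      (fun V y i => ?_) hB hZ.le hm hW).seq ((run_countDigits (by omega) _).seq
        ((run_emit rfl).seq ((run_clear _).seq (run_setF rfl)))))))).mono ?_
  · simp only [NExp.eval, input]
    rw [mem_store_of_lt (by omega)]
  · have : Z / B ^ (inp 1 + 1) ≤ W := (Nat.div_le_self _ _).trans hZ.le
    simp only [NExp.cost, FExp.cost, List.length_cons, List.length_nil]
    nlinarith

end Coordinate

section Program

variable {K : Type*} [Field K] {elem : ℕ → K} {inp : ℕ → ℕ} {ρ : Regs} {f : K} {out : List K}

/-- The point number `Z` is printed, one coordinate after the other. -/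
def printPoint : Prog := forLoop .r (input 0) printCoordinate

theorem run_printPoint {B T Z W : ℕ} (hB : 0 < B) (hn : inp 0 ≤ W) (hZ : Z < W)
    (hbase : ∀ r < inp 0, inp (4 + r) + 1 ≤ W) (hm : inp 1 + 1 ≤ W) :
    Run elem printPoint (2100 * W ^ 3) (store inp { B := B, T := T, Z := Z } 0 out)
      (store inp { B := B, T := T, Z := Z } 0
        (out ++ (List.range (inp 0)).map (coordinate elem inp B Z))) := by
  have hloop := run_forLoop (elem := elem) (inp := inp) (a := .r) (lim := input 0)
    (p := printCoordinate) (c := 2000 * W ^ 2) (fun _ => { B := B, T := T, Z := Z }) (fun _ => 0)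
    (fun t => out ++ (List.range t).map (coordinate elem inp B Z)) (by simp) hn (by omega)
    (fun t => by
      simp only [NExp.eval, input]
      rw [mem_store_of_lt (by omega)])
    (fun t ht => by
      rw [List.range_succ, List.map_append, ← List.append_assoc]
      exact run_printCoordinate hB ht (by omega) hZ (hbase t ht) hm)
  rw [List.range_zero, List.map_nil, List.append_nil] at hloop
  refine hloop.mono ?_
  have : W ≤ W ^ 3 := Nat.le_self_pow (by omega) W
  linarith [pow_succ W 2]

/-- The points with the numbers below `T` are printed. -/
def printPoints : Prog := forLoop .Z (reg .T) printPoint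

theorem run_printPoints {B T W : ℕ} (hB : 0 < B) (hn : inp 0 ≤ W) (hT : T ≤ W)
    (hbase : ∀ r < inp 0, inp (4 + r) + 1 ≤ W) (hm : inp 1 + 1 ≤ W) :
    Run elem printPoints (2200 * W ^ 4) (store inp { B := B, T := T } 0 [])
      (store inp { B := B, T := T } 0 ((List.range T).flatMap fun Z =>
        (List.range (inp 0)).map (coordinate elem inp B Z))) := by
  have hloop := run_forLoop (elem := elem) (inp := inp) (a := .Z) (lim := reg .T)
    (p := printPoint) (c := 2100 * W ^ 3) (fun _ => { B := B, T := T }) (fun _ => 0)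
    (fun t => (List.range t).flatMap fun Z => (List.range (inp 0)).map (coordinate elem inp B Z))
    (by simp) hT (by omega) (fun t => by simp only [eval_reg]; rfl)
    (fun t ht => by
      rw [List.range_succ, List.flatMap_append, List.flatMap_singleton]
      exact run_printPoint hB hn (by omega) hbase hm)
  refine hloop.mono ?_
  have : W ≤ W ^ 4 := Nat.le_self_pow (by omega) W
  linarith [pow_succ W 3]

/-- Multiplication of the register `V` by the value of `D`. -/
def mulBy (D : NExp) : Prog :=
  .seq (clear [.y]) (.seq (forLoop .j D (assign .y (.add (reg .y) (reg .V)))) takeOver)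

theorem run_mulBy {D : NExp} {d W : ℕ} (hcost : D.cost ≤ 20)
    (hD : ∀ y j, D.eval (store inp { ρ with y := y, j := j } f out).mem = d) (hd : d ≤ W)
    (hW : 1 ≤ W) :
    Run elem (mulBy D) (150 * W) (store inp ρ f out)
      (store inp { ρ with V := ρ.V * d, y := 0, j := 0 } f out) := by
  have hloop := run_forLoop (elem := elem) (inp := inp) (a := .j) (lim := D)
    (p := assign .y (.add (reg .y) (reg .V))) (c := 16) (fun t => { ρ with y := ρ.V * t })
    (fun _ => f) (fun _ => out) hcost hd hW (fun t => hD _ _)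
    (fun t _ => (run_assign (x := ρ.V * (t + 1)) (by
      simp only [NExp.eval, eval_reg, Regs.get, Regs.set, mul_add, mul_one])).mono
        (by simp [NExp.cost]))
  rw [mul_zero] at hloop
  refine ((run_clear [.y]).seq (hloop.seq run_takeOver)).mono ?_
  simp only [List.length_singleton]
  omega

/-- Multiplication of the register `V` by the power of the value of `D` whose exponent is the
value of `N`. -/
def mulByPow (D N : NExp) : Prog := forLoop .i N (mulBy D)

theorem run_mulByPow {D N : NExp} {d e W : ℕ} (hcostD : D.cost ≤ 20) (hcostN : N.cost ≤ 20)
    (hD : ∀ V y j i, D.eval (store inp { ρ with V := V, y := y, j := j, i := i } f out).mem = d)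
    (hN : ∀ V y j i, N.eval (store inp { ρ with V := V, y := y, j := j, i := i } f out).mem = e)
    (hd : d ≤ W) (he : e ≤ W) (hW : 1 ≤ W) :
    Run elem (mulByPow D N) (250 * W ^ 2) (store inp { ρ with y := 0, j := 0 } f out)
      (store inp { ρ with V := ρ.V * d ^ e, y := 0, j := 0, i := 0 } f out) := by
  have hloop := run_forLoop (elem := elem) (inp := inp) (a := .i) (lim := N) (p := mulBy D)
    (c := 150 * W) (fun t => { ρ with V := ρ.V * d ^ t, y := 0, j := 0 })
    (fun _ => f) (fun _ => out) hcostN he hW (fun t => hN _ _ _ _)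
    (fun t _ => by
      rw [pow_succ, ← mul_assoc]
      exact run_mulBy hcostD (fun _ _ => hD _ _ _ _) hd hW)
  rw [pow_zero, mul_one] at hloop
  refine hloop.mono ?_
  nlinarith

/-- `P` is doubled and `V` is multiplied by `(n + 1) ^ (5 * δ)`. -/
def scaleBase : Prog :=
  .seq (assign .P (.add (reg .P) (reg .P))) (mulByPow (.add (input 0) (.const 1))
    (.add (input 2) (.add (input 2) (.add (input 2) (.add (input 2) (input 2))))))

theorem run_scaleBase {P V W : ℕ} (hn : inp 0 + 1 ≤ W) (hδ : 5 * inp 2 ≤ W) :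
    Run elem scaleBase (250 * W ^ 2 + 20) (store inp { P := P, V := V } f out)
      (store inp { P := P + P, V := V * (inp 0 + 1) ^ (5 * inp 2) } f out) := by
  have hpow := run_mulByPow (elem := elem) (inp := inp) (f := f) (out := out) (W := W)
    (ρ := { P := P + P, V := V }) (D := .add (input 0) (.const 1)) (d := inp 0 + 1)
    (N := .add (input 2) (.add (input 2) (.add (input 2) (.add (input 2) (input 2)))))
    (e := 5 * inp 2) (by simp [NExp.cost]) (by simp [NExp.cost])
    (fun _ _ _ _ => by
      simp only [NExp.eval, input]
      rw [mem_store_of_lt (by omega)])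
    (fun _ _ _ _ => by
      simp only [NExp.eval, input]
      rw [mem_store_of_lt (by omega)]
      omega)
    hn hδ (by omega)
  refine ((run_assign (x := P + P) (by simp only [NExp.eval, eval_reg, Regs.get])).seq
    hpow).mono ?_
  simp only [NExp.cost, cost_reg]
  omega

/-- The base `(n + 1) ^ (5 * δ * ⌈log₂ (k + 1)⌉)` of the digits, in the registers `V` and `B`. -/
def computeBase : Prog :=
  .seq (assign .P (.const 1)) (.seq (assign .V (.const 1))
    (.seq (.while (reg .P) (.add (input 3) (.const 1)) scaleBase)
      (.seq (assign .B (reg .V)) (clear [.P]))))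

theorem run_computeBase {W : ℕ} (hn : inp 0 + 1 ≤ W) (hδ : 5 * inp 2 ≤ W)
    (hl : Nat.clog 2 (inp 3 + 1) ≤ W) :
    Run elem computeBase (400 * W ^ 3) (store inp {} f out)
      (store inp { V := ((inp 0 + 1) ^ (5 * inp 2)) ^ Nat.clog 2 (inp 3 + 1),
                   B := ((inp 0 + 1) ^ (5 * inp 2)) ^ Nat.clog 2 (inp 3 + 1) } f out) := by
  have hk : ∀ ρ : Regs, (NExp.add (input 3) (.const 1)).eval (store inp ρ f out).mem
      = inp 3 + 1 := fun ρ => by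
    simp only [NExp.eval, input]
    rw [mem_store_of_lt (by omega)]
  have hwhile := Run.while_of_forall_lt (elem := elem) (a := reg .P)
    (b := .add (input 3) (.const 1)) (p := scaleBase)
    (fun t => store inp { P := 2 ^ t, V := ((inp 0 + 1) ^ (5 * inp 2)) ^ t } f out)
    (Nat.clog 2 (inp 3 + 1))
    (fun t ht => by
      rw [hk, eval_reg]
      exact (Nat.lt_clog_iff_pow_lt one_lt_two).1 ht)
    (by
      rw [hk, eval_reg]
      exact not_lt.2 (Nat.le_pow_clog one_lt_two _))
    (fun t _ => by
      rw [pow_succ 2, mul_two, pow_succ (_ ^ _)]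
      exact run_scaleBase hn hδ)
  refine ((run_assign rfl).seq ((run_assign rfl).seq (hwhile.seq
    ((run_copy .B .V).seq (run_clear _))))).mono ?_
  simp only [NExp.cost, cost_reg, cost_input, List.length_singleton]
  have : 1 ≤ W := by omega
  have : W ≤ W ^ 3 := Nat.le_self_pow (by omega) W
  have := Nat.mul_le_mul hl (le_refl (5 + (2 + 1 + 1) + (250 * W ^ 2 + 20) + 1))
  linarith [pow_succ W 2]

/-- The number `B ^ (2 * m + 1)` of points, in the register `T`. -/
def computeBound : Prog :=
  .seq (mulByPow (reg .B) (.add (input 1) (input 1))) (.seq (assign .T (reg .V)) (clear [.V]))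

theorem run_computeBound {B W : ℕ} (hB : B ≤ W) (hm : 2 * inp 1 ≤ W) (hW : 1 ≤ W) :
    Run elem computeBound (300 * W ^ 2) (store inp { V := B, B := B } f out)
      (store inp { B := B, T := B ^ (2 * inp 1 + 1) } f out) := by
  have hpow := run_mulByPow (elem := elem) (inp := inp) (f := f) (out := out) (W := W)
    (ρ := { V := B, B := B }) (D := reg .B) (N := .add (input 1) (input 1)) (d := B)
    (e := 2 * inp 1) (by simp) (by simp [NExp.cost]) (fun _ _ _ _ => by simp only [eval_reg]; rfl)
    (fun _ _ _ _ => by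
      simp only [NExp.eval, input]
      rw [mem_store_of_lt (by omega), two_mul])
    hB hm hW
  rw [← pow_succ'] at hpow
  refine (hpow.seq ((run_copy .T .V).seq (run_clear _))).mono ?_
  simp only [List.length_singleton]
  nlinarith

/-- The program that prints the hitting-set. -/
def hittingSetProg : Prog := .seq computeBase (.seq computeBound printPoints)

theorem run_hittingSetProg {B W : ℕ}
    (hB : B = ((inp 0 + 1) ^ (5 * inp 2)) ^ Nat.clog 2 (inp 3 + 1)) (hn : inp 0 + 1 ≤ W)
    (hδ : 5 * inp 2 ≤ W) (hl : Nat.clog 2 (inp 3 + 1) ≤ W) (hT : B ^ (2 * inp 1 + 1) ≤ W)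
    (hm : 2 * inp 1 ≤ W) (hm' : inp 1 + 1 ≤ W) (hbase : ∀ r < inp 0, inp (4 + r) + 1 ≤ W) :
    Run elem hittingSetProg (3000 * W ^ 4) (store inp {} 0 [])
      (store inp { B := B, T := B ^ (2 * inp 1 + 1) } 0
        ((List.range (B ^ (2 * inp 1 + 1))).flatMap fun Z =>
          (List.range (inp 0)).map (coordinate elem inp B Z))) := by
  have hBW : B ≤ W := (Nat.le_self_pow (by omega) B).trans hT
  have hB0 : 0 < B := hB ▸ by positivity
  subst hB
  refine ((run_computeBase hn hδ hl).seq ((run_computeBound hBW hm (by omega)).seq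
    (run_printPoints hB0 (by omega) hT hbase hm'))).mono ?_
  have hW : 1 ≤ W := by omega
  have h2 : W ^ 2 ≤ W ^ 4 := Nat.pow_le_pow_right hW (by omega)
  have h3 : W ^ 3 ≤ W ^ 4 := Nat.pow_le_pow_right hW (by omega)
  have h4 : 1 ≤ W ^ 4 := Nat.one_le_pow _ _ hW
  omega

end Program

section Output

open HittingSet

variable {K : Type*} [Field K] {n m : ℕ}

theorem mem_initState (δ k : ℕ) (base : Fin n → Fin m) (r : Fin n) :
    (initState K δ k base).mem (4 + r) = base r := by
  simp only [initState, Nat.add_sub_cancel_left, r.isLt, dite_true]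
  rw [if_neg (by omega), if_neg (by omega), if_neg (by omega), if_neg (by omega)]

theorem store_initState (δ k : ℕ) (base : Fin n → Fin m) :
    store (initState K δ k base).mem {} 0 [] = initState K δ k base := by
  have hcell : ∀ p, ({} : Regs).cell p = 0 := fun p => by
    by_cases hp : p < 12
    · interval_cases p <;> rfl
    · simp [Regs.cell, not_lt.1 hp]
  simp only [store, initState, State.mk.injEq, and_true, hcell]
  refine ⟨funext fun a => ?_, by simp⟩
  split_ifs <;> omega

theorem map_coordinate_initState (elem : ℕ → K) (δ k : ℕ) (base : Fin n → Fin m) (B Z : ℕ) :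
    (List.range n).map (coordinate elem (initState K δ k base).mem B Z) =
      List.ofFn (point elem base B Z) := by
  rw [← List.map_coe_finRange_eq_range, List.map_map, List.ofFn_eq_map]
  refine List.map_congr_left fun r _ => ?_
  rw [Function.comp_apply, coordinate, mem_initState]
  rfl

theorem digitBase_pow_le (n δ k : ℕ) (hm : 1 ≤ m) :
    digitBase n δ k ^ (2 * m + 1) ≤ (n + 1) ^ (15 * (m * δ * Nat.clog 2 (k + 1))) := by
  rw [digitBase, ← pow_mul]
  refine Nat.pow_le_pow_right (by omega) ?_
  nlinarith [Nat.mul_le_mul_right (δ * Nat.clog 2 (k + 1)) hm]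

theorem exists_prints_points (elem : ℕ → K) {δ k : ℕ} (base : Fin n → Fin m) (hn : 1 ≤ n)
    (hδ : 1 ≤ δ) (hk : 1 ≤ k) :
    ∃ t, Prints elem hittingSetProg δ k base t (points elem δ k base) ∧
      t ≤ (n + 1) ^ (75 * (m * δ * Nat.clog 2 (k + 1))) := by
  set l := Nat.clog 2 (k + 1)
  set W := (n + 1) ^ (15 * (m * δ * l)) with hW
  have hl1 : 1 ≤ l := Nat.clog_pos one_lt_two (by omega)
  have hm1 : 1 ≤ m := (base ⟨0, hn⟩).pos
  have hlt : ∀ x ≤ 15 * (m * δ * l), x + 1 ≤ W := fun x hx =>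
    (Nat.succ_le_of_lt (hx.trans_lt Nat.lt_two_pow_self)).trans (Nat.pow_le_pow_left (by omega) _)
  have hm : m ≤ m * δ * l := by
    rw [mul_assoc]
    exact Nat.le_mul_of_pos_right m (Nat.mul_pos hδ hl1)
  have hδ' : δ ≤ m * δ * l := (Nat.le_mul_of_pos_left δ hm1).trans (Nat.le_mul_of_pos_right _ hl1)
  have hl' : l ≤ m * δ * l := Nat.le_mul_of_pos_left l (Nat.mul_pos hm1 hδ)
  obtain ⟨t, ht, he⟩ := run_hittingSetProg (K := K) (elem := elem)
    (inp := (initState K δ k base).mem) (B := digitBase n δ k) (W := W)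
    (by rw [digitBase, ← mul_assoc, pow_mul]; rfl)
    (Nat.le_self_pow (by omega) _) ((Nat.le_succ _).trans (hlt (5 * δ) (by omega)))
    ((Nat.le_succ _).trans (hlt l (by omega))) (digitBase_pow_le n δ k hm1)
    ((Nat.le_succ _).trans (hlt (2 * m) (by omega)))
    (hlt m (by omega)) (fun r hr => by
      rw [mem_initState δ k base ⟨r, hr⟩]
      exact hlt _ ((base ⟨r, hr⟩).isLt.le.trans (by omega)))
  rw [store_initState] at he
  refine ⟨t, ⟨_, he, ?_⟩, ht.trans ?_⟩
  · rw [points, List.flatMap_map]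
    exact congrArg (List.flatMap · _) (funext fun Z => map_coordinate_initState elem δ k base _ Z)
  · calc 3000 * W ^ 4 ≤ W * W ^ 4 := Nat.mul_le_mul_right _ ?_
      _ = (n + 1) ^ (75 * (m * δ * l)) := by rw [hW, ← pow_succ', ← pow_mul]; ring_nf
    calc 3000 ≤ 2 ^ 15 := by norm_num
      _ ≤ (n + 1) ^ (15 * (m * δ * l)) :=
        (Nat.pow_le_pow_left (by omega) 15).trans (Nat.pow_le_pow_right (by omega) (by omega))

end Output

end FieldRAM

theorem theorem2 :
    -- the hitting-set and its running time
    (∃ (p : FieldRAM.Prog) (c : ℕ),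
      ∀ (K : Type v) [Field K] (elem : ℕ → K) (n m δ k : ℕ) (base : Fin n → Fin m),
        1 ≤ n → 1 ≤ δ → 1 ≤ k →
        Set.InjOn elem (Set.Iio ((n + 1) ^ (c * (δ * Nat.clog 2 (k + 1))))) →
        ∃ (t : ℕ) (H : List (Fin n → K)),
          FieldRAM.Prints elem p δ k base t H ∧
          t ≤ (n + 1) ^ (c * (m * δ * Nat.clog 2 (k + 1))) ∧
          ∀ (F : Type u) [Field F] [Algebra F K] (Q : Depth3Circuit F n k),
            Q.IsMultilinear → Q.HasBaseSetsDistance base δ → Q.poly ≠ 0 →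
            ∃ x ∈ H, MvPolynomial.aeval x Q.poly ≠ 0) ∧
    -- the concentration after the shift
    (∀ (F : Type u) [Field F] (n m δ k : ℕ) (base : Fin n → Fin m) (w : Fin n → ℕ)
      (Q : Depth3Circuit F n k), 1 ≤ δ → 1 ≤ k →
        Q.IsMultilinear → Q.HasBaseSetsDistance base δ →
        SeparatesBaseSets base w (δ * Nat.clog 2 (k + 1)) →
        IsConcentrated (Q.shiftedGate base w)
          (m * ((Nat.clog 2 (k + 1) + δ + 1) - 1) + 1)) := by
  refine ⟨⟨FieldRAM.hittingSetProg, 75, fun K _ elem n m δ k base hn hδ hk helem => ?_⟩,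
    fun F _ n m δ k base w Q hδ _ _ hQ hw => ?_⟩
  · obtain ⟨t, hprints, ht⟩ := FieldRAM.exists_prints_points elem base hn hδ hk
    have hmono : HittingSet.digitBase n δ k ≤ (n + 1) ^ (75 * (δ * Nat.clog 2 (k + 1))) :=
      Nat.pow_le_pow_right (by omega) (Nat.mul_le_mul_right _ (by norm_num))
    exact ⟨t, _, hprints, ht, fun F _ _ Q _ hQ h0 => Q.exists_mem_points_aeval_ne_zero hn hδ hk
      (helem.mono (Set.Iio_subset_Iio hmono)) hQ h0⟩
  · rw [show Q.shiftedGate base w = _ from funext Depth3Circuit.shiftedGate_eq_map_polyGate]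
    refine isConcentrated_map fun a hlow => ?_
    exact Depth3Circuit.eq_zero_of_forall_support_card_le hδ hQ hw rfl fun S hS =>
      hlow S (Nat.lt_succ_of_le hS)
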